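/- Let $a$ be a positive integer and $s$ an odd integer. For $\tau$ in the upper half-plane ${\frak H}$ and $z\in{\Bbb C}$ put $q=\exp(2\pi i\tau)$, $u=\exp(2\pi i z)$, and $q^x=\exp(2\pi i x\tau)$, $u^x=\exp(2\pi i xz)$ for $x\in{\Bbb Q}$. The series $$F_{a,s}(z,\tau)=u^{\frac{s}{2a}}\sum_{n\in{\Bbb Z}}\frac{(-1)^nq^{\frac{n^2+sn}{2}}}{1-q^{an}u}$$ converges absolutely and is holomorphic at all points $(z,\tau)\in{\Bbb C}\times{\frak H}$ with $q^{an}u\neq 1$ for all $n\in{\Bbb Z}$, and it defines a meromorphic Jacobi form of weight $1$ on ${\Bbb C}\times{\frak H}$. That is, $F_{a,s}$ is meromorphic on ${\Bbb C}\times{\frak H}$ and, for the bilinear form $v\cdot w=-vw/a^2$ and some lattice $\Lambda=N{\Bbb Z}$ ($N\ge 1$ an integer) on which this form is integer-valued, and for some congruence subgroup $\Gamma\subset\operatorname{SL}_2({\Bbb Z})$, the following identities of meromorphic functions hold: $$F_{a,s}(z+v\tau+w,\tau)=(-1)^{v\cdot w}\exp(-\pi i\tau\, v\cdot v-2\pi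 i\, v\cdot z)F_{a,s}(z,\tau),$$ $$F_{a,s}\Bigl(\frac{z}{\gamma\tau+\delta},\frac{\alpha\tau+\beta}{\gamma\tau+\delta}\Bigr)=(\gamma\tau+\delta)\exp\Bigl(\pi i\frac{\gamma\, z\cdot z}{\gamma\tau+\delta}\Bigr)F_{a,s}(z,\tau)$$ for all $v,w\in\Lambda$ and $\begin{pmatrix}\alpha&\beta\\ \gamma&\delta\end{pmatrix}\in\Gamma$. In the case $a=2$ one has, for every odd integer $s$ and all $(z,\tau)\in{\Bbb C}\times{\frak H}$ with $q^{2n}u\neq1$ for all $n\in{\Bbb Z}$, $$\sum_{n\in{\Bbb Z}}\frac{(-1)^nq^{\frac{n^2+ns}{2}}}{1-q^{2n}u}=\varphi(q^2)^3\,\frac{\sum_{n\in{\Bbb Z}} q^{2n^2+n(s-2)}u^n}{\bigl(\sum_{n\in{\Bbb Z}}(-1)^nq^{n^2-n}u^n\bigr)\bigl(\sum_{n\in{\Bbb Z}}q^{2n^2+n(s-2)}\bigr)},\qquad \varphi(q)=\prod_{n\ge1}(1-q^n),$$ where all the series and the product converge absolutely and the denominator does not vanish. -/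

import Mathlib

open Complex Filter Topology
open scoped MatrixGroups

/-- A complex-valued function on a complex normed space is meromorphic at `p` if, near `p`, it is
a quotient `g / h` of two holomorphic functions, where `h` does not vanish identically near `p`.
As for Mathlib's one-variable `MeromorphicAt`, the values on the thin set `h = 0` are irrelevant. -/
def IsMeromorphicAt {X : Type*} [NormedAddCommGroup X] [NormedSpace ℂ X] (f : X → ℂ) (p : X) :
    Prop :=
  ∃ g h : X → ℂ, AnalyticAt ℂ g p ∧ AnalyticAt ℂ h p ∧ (∃ᶠ x in 𝓝 p, h x ≠ 0) ∧
    ∀ᶠ x in 𝓝 p, h x ≠ 0 → f x = g x / h x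

/-- Meromorphic Jacobi forms of weight `k` with respect to `(Λ, B, Γ)`. Here `Λ` is a lattice, the
vector space `E` is its complexification `Λ ⊗ ℂ`, `B` is the complex-bilinear extension of a
symmetric integer-valued bilinear form on `Λ` (so `Q v = B v v`), `Γ` is a congruence subgroup of
`SL(2, ℤ)`, and `f (z, τ)` is a meromorphic function on `E × ℍ` (only the values with `0 < im τ`
are used). The two transformation laws are identities between meromorphic functions: they are
required at all points where both sides are regular (a dense open set of points). The sign
`(-1) ^ (B v w)` is written `exp (π i B v w)`. -/
structure IsMeromorphicJacobiForm {E : Type*} [NormedAddCommGroup E] [NormedSpace ℂ E]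
    (k : ℤ) (Λ : Submodule ℤ E) (B : LinearMap.BilinForm ℂ E) (Γ : Subgroup SL(2, ℤ))
    (f : E × ℂ → ℂ) : Prop where
  lattice : ∃ (r : ℕ) (b : Module.Basis (Fin r) ℂ E), Λ = Submodule.span ℤ (Set.range b)
  symm : ∀ v w : E, B v w = B w v
  integral : ∀ v ∈ Λ, ∀ w ∈ Λ, ∃ m : ℤ, B v w = (m : ℂ)
  congruence : CongruenceSubgroup.IsCongruenceSubgroup Γ
  meromorphic : ∀ (z : E) (τ : ℂ), 0 < τ.im → IsMeromorphicAt f (z, τ)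
  elliptic : ∀ v ∈ Λ, ∀ w ∈ Λ, ∀ (z : E) (τ : ℂ), 0 < τ.im →
    AnalyticAt ℂ f (z, τ) → AnalyticAt ℂ f (z + τ • v + w, τ) →
    f (z + τ • v + w, τ) =
      cexp (Real.pi * I * B v w) * cexp (-(Real.pi * I * τ * B v v) - 2 * Real.pi * I * B v z)
        * f (z, τ)
  modular : ∀ γ ∈ Γ, ∀ (z : E) (τ : ℂ), 0 < τ.im →
    AnalyticAt ℂ f (z, τ) →
    AnalyticAt ℂ f (((γ 1 0 : ℂ) * τ + (γ 1 1 : ℂ))⁻¹ • z,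
      ((γ 0 0 : ℂ) * τ + (γ 0 1 : ℂ)) / ((γ 1 0 : ℂ) * τ + (γ 1 1 : ℂ))) →
    f (((γ 1 0 : ℂ) * τ + (γ 1 1 : ℂ))⁻¹ • z,
        ((γ 0 0 : ℂ) * τ + (γ 0 1 : ℂ)) / ((γ 1 0 : ℂ) * τ + (γ 1 1 : ℂ))) =
      ((γ 1 0 : ℂ) * τ + (γ 1 1 : ℂ)) ^ k
        * cexp (Real.pi * I * ((γ 1 0 : ℂ) * B z z / ((γ 1 0 : ℂ) * τ + (γ 1 1 : ℂ))))
        * f (z, τ)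

/-- `qpow τ x = q ^ x` with `q = exp (2 π i τ)`. The same function gives the powers of
`u = exp (2 π i z)`, as `qpow z x = u ^ x`. -/
noncomputable def qpow (τ x : ℂ) : ℂ := cexp (2 * Real.pi * I * τ * x)

/-- The general term `(-1)^n q^((n² + s n) / 2) / (1 - q^(a n) u)`. -/
noncomputable def appellTerm (a : ℕ) (s : ℤ) (z τ : ℂ) (n : ℤ) : ℂ :=
  (-1) ^ n * qpow τ (((n : ℂ) ^ 2 + s * n) / 2) / (1 - qpow τ (a * n) * qpow z 1)

/-- The function `u^(s / (2 a)) ∑_n (-1)^n q^((n² + s n) / 2) / (1 - q^(a n) u)` of `(z, τ)`. -/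
noncomputable def appellForm (a : ℕ) (s : ℤ) (p : ℂ × ℂ) : ℂ :=
  qpow p.1 (s / (2 * a)) * ∑' n : ℤ, appellTerm a s p.1 p.2 n

/-- The function `φ(q) = ∏_{n ≥ 1} (1 - q^n)`. -/
noncomputable def eulerProd (q : ℂ) : ℂ := ∏' n : ℕ, (1 - q ^ (n + 1))

/-! Put y = exp(2πiw) and θ(y) = ∑ (-1)^n q^(n(n-1)/2) y^n. Dividing θ by 1 - q^n y leaves a Laurent
series whose coefficients are partial sums of (-1)^m q^(m(m-1)/2). The antisymmetry m ↦ 1 - m makes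
these partial sums even in the index, hence of Gaussian decay on both sides. Double series over n
and the power of y therefore converge absolutely and may be summed in either order.

With the weight q^(nm), every coefficient but one vanishes. This is the partial fraction expansion
of y^(-m) `thetaNull` / θ (`tsum_div_mul_thetaSum`), the case a = 1. For general a, the identity
1/(1 - x^a) = (1/a) ∑ 1/(1 - ζ^k x) over the a-th roots of unity writes F as a finite combination of
`recipTheta` at (z + k)/a (`appellForm_eq_recipThetaSum`). The function `recipTheta` has weight one
and transforms under all of SL(2, ℤ): the law of θ under S comes from `jacobiTheta₂`, and
differentiating it at w = 0 gives that of `thetaNull`. Restricting to shifts by 2a² and to Γ(2a²)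
makes each summand transform separately with the same factor.

For a = 2 the same expansion is used with θ at 2τ. The coefficient of y^M is then q^(2M² + dM), d =
s - 2, times a constant independent of M. Setting y = 1, where θ vanishes, identifies the constant.
Finally `thetaNull` is the cube of Euler's product (`thetaNull_eq_eulerProd`), by Jacobi's identity,
obtained as a limit of the q-binomial theorem. -/

/-! ### Exponentials and Gaussian majorants -/

lemma qpow_add (τ x y : ℂ) : qpow τ (x + y) = qpow τ x * qpow τ y := by
  simp only [qpow, mul_add, Complex.exp_add]

lemma qpow_add_left (τ τ' x : ℂ) : qpow (τ + τ') x = qpow τ x * qpow τ' x := by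
  simp only [qpow, ← Complex.exp_add]; ring_nf

@[simp] lemma qpow_zero (τ : ℂ) : qpow τ 0 = 1 := by simp [qpow]

lemma qpow_ne_zero (τ x : ℂ) : qpow τ x ≠ 0 := Complex.exp_ne_zero _

lemma qpow_neg (τ x : ℂ) : qpow τ (-x) = (qpow τ x)⁻¹ := by
  simp [qpow, Complex.exp_neg]

lemma norm_qpow (τ : ℂ) (x : ℝ) : ‖qpow τ x‖ = Real.exp (-(2 * Real.pi * τ.im * x)) := by
  rw [qpow, Complex.norm_exp]
  simp

lemma norm_qpow_of_eq {τ x : ℂ} {y : ℝ} (h : x = y) :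
    ‖qpow τ x‖ = Real.exp (-(2 * Real.pi * τ.im * y)) := by
  rw [h, norm_qpow]

lemma qpow_int_eq_one_iff {τ : ℂ} (hτ : 0 < τ.im) (n : ℤ) : qpow τ n = 1 ↔ n = 0 := by
  refine ⟨fun h ↦ ?_, fun h ↦ by simp [h]⟩
  have := norm_qpow_of_eq (τ := τ) (x := n) (y := n) (by simp)
  rw [h, norm_one, eq_comm, Real.exp_eq_one_iff] at this
  have hpi := Real.pi_pos
  have h2 : (2 * Real.pi * τ.im) ≠ 0 := by positivity
  have h3 : (2 * Real.pi * τ.im) * (n : ℝ) = 0 := by linarith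
  exact_mod_cast (mul_eq_zero.mp h3).resolve_left h2

lemma summable_abs_mul_exp_quadratic {A : ℝ} (hA : 0 < A) (B : ℝ) (k : ℕ) :
    Summable fun n : ℤ ↦ |(n : ℝ)| ^ k * Real.exp (-A * n ^ 2 + B * n) := by
  have hpi := Real.pi_pos
  refine (summable_pow_mul_jacobiTheta₂_term_bound (|B| / (2 * Real.pi))
    (T := A / Real.pi) (by positivity) k).of_nonneg_of_le (fun n ↦ by positivity) fun n ↦ ?_
  rw [Int.cast_abs]
  gcongr
  have h1 : -Real.pi * (A / Real.pi * (n : ℝ) ^ 2 - 2 * (|B| / (2 * Real.pi)) * |(n : ℝ)|)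
      = -A * n ^ 2 + |B| * |(n : ℝ)| := by field_simp; ring
  rw [h1, ← abs_mul]
  gcongr
  exact le_abs_self _

lemma summable_exp_quadratic {A : ℝ} (hA : 0 < A) (B : ℝ) :
    Summable fun n : ℤ ↦ Real.exp (-A * n ^ 2 + B * n) := by
  simpa using summable_abs_mul_exp_quadratic hA B 0

/-! ### Theta coefficients and their partial sums -/

/-- The coefficients `(-1)^n q^(n (n - 1) / 2)` of the theta function. -/
noncomputable def thetaCoeff (τ : ℂ) (n : ℤ) : ℂ := (-1) ^ n * qpow τ (((n : ℂ) ^ 2 - n) / 2)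

/-- The theta function `∑_n (-1)^n q^(n (n - 1) / 2) y^n` with `y = exp (2 π i w)`. -/
noncomputable def thetaSum (w τ : ℂ) : ℂ := ∑' n : ℤ, thetaCoeff τ n * qpow w n

/-- The partial sums `∑_{m ≤ k} (-1)^m q^(m (m - 1) / 2)`. -/
noncomputable def thetaPartial (τ : ℂ) (k : ℤ) : ℂ := ∑' i : ℕ, thetaCoeff τ (k - i)

/-- The sum of all `∑_{m ≤ k} (-1)^m q^(m (m - 1) / 2)`. -/
noncomputable def thetaNull (τ : ℂ) : ℂ := ∑' k : ℤ, thetaPartial τ k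

lemma norm_neg_one_zpow (n : ℤ) : ‖(-1 : ℂ) ^ n‖ = 1 := by simp [norm_zpow]

lemma norm_thetaCoeff (τ : ℂ) (n : ℤ) :
    ‖thetaCoeff τ n‖ = Real.exp (-(Real.pi * τ.im * (n ^ 2 - n))) := by
  rw [thetaCoeff, norm_mul, norm_neg_one_zpow, one_mul,
    norm_qpow_of_eq (y := ((n : ℝ) ^ 2 - n) / 2) (by push_cast; ring)]
  congr 1; ring

lemma summable_pow_mul_thetaCoeff {τ : ℂ} (hτ : 0 < τ.im) (w : ℂ) (k : ℕ) :
    Summable fun n : ℤ ↦ (n : ℂ) ^ k * (thetaCoeff τ n * qpow w n) := by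
  have hpi := Real.pi_pos
  refine .of_norm_bounded (summable_abs_mul_exp_quadratic (A := Real.pi * τ.im) (by positivity)
    (Real.pi * τ.im - 2 * Real.pi * w.im) k) fun n ↦ ?_
  rw [norm_mul, norm_mul, norm_thetaCoeff, norm_qpow_of_eq (y := (n : ℝ)) (by simp), norm_pow,
    Complex.norm_intCast, ← Real.exp_add]
  refine mul_le_mul_of_nonneg_left (Real.exp_le_exp.mpr (le_of_eq ?_)) (by positivity)
  ring

lemma summable_thetaCoeff_mul {τ : ℂ} (hτ : 0 < τ.im) (w : ℂ) :
    Summable fun n : ℤ ↦ thetaCoeff τ n * qpow w n := by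
  simpa using summable_pow_mul_thetaCoeff hτ w 0

lemma summable_thetaCoeff {τ : ℂ} (hτ : 0 < τ.im) : Summable (thetaCoeff τ) := by
  simpa [qpow] using summable_thetaCoeff_mul hτ 0

lemma thetaCoeff_one_sub (τ : ℂ) (n : ℤ) : thetaCoeff τ (1 - n) = -thetaCoeff τ n := by
  have h : ((((1 - n : ℤ) : ℂ)) ^ 2 - ((1 - n : ℤ) : ℂ)) / 2 = ((n : ℂ) ^ 2 - n) / 2 := by
    push_cast; ring
  rw [thetaCoeff, thetaCoeff, h, zpow_sub₀ (by norm_num), zpow_one]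
  rcases Int.even_or_odd n with hn | hn
  · simp [hn.neg_one_zpow]
  · simp [hn.neg_one_zpow]

lemma thetaPartial_sub {τ : ℂ} (hτ : 0 < τ.im) (k : ℤ) :
    thetaPartial τ k - thetaPartial τ (k - 1) = thetaCoeff τ k := by
  have hs : Summable fun i : ℕ ↦ thetaCoeff τ (k - i) :=
    (summable_thetaCoeff hτ).comp_injective (i := fun i : ℕ ↦ k - (i : ℤ))
      (fun a b h ↦ by simpa using h)
  rw [thetaPartial, thetaPartial, hs.tsum_eq_zero_add]
  have : (fun i : ℕ ↦ thetaCoeff τ (k - ((i + 1 : ℕ) : ℤ))) =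
      fun i : ℕ ↦ thetaCoeff τ (k - 1 - i) := by
    ext i; congr 1; push_cast; ring
  rw [this]; simp

/-- By `thetaCoeff_one_sub`, the difference of the two sides does not change when k moves by one,
and it is zero at k = 0. -/
lemma thetaPartial_neg {τ : ℂ} (hτ : 0 < τ.im) (k : ℤ) :
    thetaPartial τ (-k) = thetaPartial τ k := by
  have step (k : ℤ) : thetaPartial τ k - thetaPartial τ (-k) =
      thetaPartial τ (k - 1) - thetaPartial τ (-(k - 1)) := by
    have h1 := thetaPartial_sub hτ k
    have h2 := thetaPartial_sub hτ (1 - k)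
    rw [thetaCoeff_one_sub, show 1 - k - 1 = -k by ring] at h2
    rw [show -(k - 1) = 1 - k by ring]
    linear_combination h1 + h2
  have key : thetaPartial τ k - thetaPartial τ (-k) = 0 := by
    induction k using Int.induction_on with
    | zero => simp
    | succ i ih => rw [step]; simpa using ih
    | pred i ih => rwa [← step]
  linear_combination -key

/-- At index -l ≤ 0 each term is at most exp(-π im(τ) l²) times a geometric term, as (l + i)² + (l +
i) ≥ l² + i. Evenness carries the bound to positive indices. -/
lemma exists_norm_thetaPartial_le {τ : ℂ} (hτ : 0 < τ.im) :
    ∃ C : ℝ, 0 ≤ C ∧ ∀ k : ℤ, ‖thetaPartial τ k‖ ≤ C * Real.exp (-(Real.pi * τ.im * k ^ 2)) := by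
  have hpi := Real.pi_pos
  have hg : Summable fun i : ℕ ↦ Real.exp (-(Real.pi * τ.im) * i) := by
    have := Real.summable_exp_nat_mul_iff.mpr (show -(Real.pi * τ.im) < 0 by
      have : 0 < Real.pi * τ.im := by positivity
      linarith)
    exact this.congr fun i ↦ by rw [mul_comm]
  refine ⟨∑' i : ℕ, Real.exp (-(Real.pi * τ.im) * i), tsum_nonneg fun _ ↦ by positivity, ?_⟩
  have neg_case (l : ℕ) : ‖thetaPartial τ (-l)‖ ≤ (∑' i : ℕ, Real.exp (-(Real.pi * τ.im) * i)) *
      Real.exp (-(Real.pi * τ.im * (-l : ℤ) ^ 2)) := by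
    rw [← tsum_mul_right]
    refine tsum_of_norm_bounded (hg.mul_right _).hasSum fun i ↦ ?_
    rw [norm_thetaCoeff, ← Real.exp_add]
    gcongr
    push_cast
    have : 0 ≤ Real.pi * τ.im * (2 * l * i + i ^ 2 + l) := by positivity
    nlinarith
  intro k
  obtain ⟨l, rfl | rfl⟩ := k.eq_nat_or_neg
  · rw [← thetaPartial_neg hτ]
    refine (neg_case l).trans_eq ?_
    push_cast; ring_nf
  · refine (neg_case l).trans_eq ?_
    push_cast; ring_nf

lemma summable_mul_thetaPartial {τ : ℂ} (hτ : 0 < τ.im) :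
    Summable fun k : ℤ ↦ (k : ℂ) * thetaPartial τ k := by
  have hpi := Real.pi_pos
  obtain ⟨C, hC, h⟩ := exists_norm_thetaPartial_le hτ
  refine .of_norm_bounded ((summable_abs_mul_exp_quadratic (A := Real.pi * τ.im) (by positivity)
    0 1).mul_left C) fun n ↦ ?_
  rw [norm_mul, Complex.norm_intCast]
  calc _ ≤ |(n : ℝ)| * (C * Real.exp (-(Real.pi * τ.im * n ^ 2))) := by gcongr; exact h n
    _ = _ := by ring_nf

lemma summable_thetaPartial {τ : ℂ} (hτ : 0 < τ.im) : Summable (thetaPartial τ) := by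
  have hpi := Real.pi_pos
  obtain ⟨C, hC, h⟩ := exists_norm_thetaPartial_le hτ
  refine .of_norm_bounded ((summable_exp_quadratic (A := Real.pi * τ.im) (by positivity)
    0).mul_left C) fun n ↦ (h n).trans_eq (by ring_nf)

/-- Summation by parts. It links the constant in the partial fractions to the derivative of theta at
w = 0. -/
lemma thetaNull_eq {τ : ℂ} (hτ : 0 < τ.im) :
    thetaNull τ = -∑' n : ℤ, (n : ℂ) * thetaCoeff τ n := by
  have h1 := summable_mul_thetaPartial hτ
  have h0 := summable_thetaPartial hτ
  have h2 : ∑' n : ℤ, (n : ℂ) * thetaPartial τ (n - 1) =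
      ∑' n : ℤ, ((n : ℂ) * thetaPartial τ n + thetaPartial τ n) := by
    rw [← (Equiv.addRight (1 : ℤ)).tsum_eq]
    refine tsum_congr fun n ↦ ?_
    simp; ring
  have hs2 : Summable fun n : ℤ ↦ (n : ℂ) * thetaPartial τ (n - 1) := by
    rw [← (Equiv.addRight (1 : ℤ)).summable_iff]
    refine (h1.add h0).congr fun n ↦ ?_
    simp; ring
  have h3 : ∑' n : ℤ, (n : ℂ) * thetaCoeff τ n =
      ∑' n : ℤ, ((n : ℂ) * thetaPartial τ n - (n : ℂ) * thetaPartial τ (n - 1)) :=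
    tsum_congr fun n ↦ by rw [← thetaPartial_sub hτ]; ring
  rw [h3, h1.tsum_sub hs2, h2, h1.tsum_add h0, thetaNull]
  ring

/-! ### Partial fractions of the reciprocal theta function -/

/-- The decay in (M - n)²/2 cancels the cross term: nM + (M - n)²/2 = (n² + M²)/2. The majorant is
thus a product of two one-variable Gaussians. -/
lemma summable_prod_thetaPartial {τ : ℂ} (hτ : 0 < τ.im) (m : ℤ) (w : ℂ) :
    Summable fun p : ℤ × ℤ ↦
      qpow τ (p.1 * (p.2 + m)) * thetaPartial τ (p.2 - p.1) * qpow w p.2 := by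
  have hpi := Real.pi_pos
  obtain ⟨C, hC, h⟩ := exists_norm_thetaPartial_le hτ
  have h1 := summable_exp_quadratic (A := Real.pi * τ.im) (by positivity)
    (-(2 * Real.pi * τ.im * m))
  have h2 := summable_exp_quadratic (A := Real.pi * τ.im) (by positivity) (-(2 * Real.pi * w.im))
  refine .of_norm_bounded ((h1.mul_of_nonneg h2 (fun _ ↦ by positivity)
    (fun _ ↦ by positivity)).mul_left C) fun p ↦ ?_
  obtain ⟨n, M⟩ := p
  rw [norm_mul, norm_mul, norm_qpow_of_eq (y := (n * (M + m) : ℝ)) (by push_cast; ring),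
    norm_qpow_of_eq (y := (M : ℝ)) (by simp)]
  calc _ ≤ Real.exp (-(2 * Real.pi * τ.im * (n * (M + m)))) *
        (C * Real.exp (-(Real.pi * τ.im * (M - n : ℤ) ^ 2))) *
        Real.exp (-(2 * Real.pi * w.im * M)) := by gcongr; exact h _
    _ = _ := by
      dsimp only
      rw [mul_left_comm, mul_assoc, ← Real.exp_add, ← Real.exp_add, ← Real.exp_add]
      push_cast; ring_nf

lemma summable_qpow_mul_thetaPartial {τ : ℂ} (hτ : 0 < τ.im) (n : ℤ) (w : ℂ) :
    Summable fun M : ℤ ↦ qpow τ (n * M) * thetaPartial τ (M - n) * qpow w M := by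
  simpa using (summable_prod_thetaPartial hτ 0 w).prod_factor n

lemma thetaCoeff_mul_qpow (τ : ℂ) (n M : ℤ) :
    qpow τ (n * M) * thetaCoeff τ (M - n) =
      (-1) ^ n * qpow τ (((n : ℂ) ^ 2 + n) / 2) * thetaCoeff τ M := by
  have h : ((-1 : ℂ)) ^ (M - n) = (-1) ^ n * (-1) ^ M := by
    rw [zpow_sub₀ (by norm_num), div_eq_mul_inv, mul_comm, ← inv_zpow]; norm_num
  rw [thetaCoeff, thetaCoeff, h]
  have : qpow τ (n * M) * qpow τ ((((M - n : ℤ) : ℂ) ^ 2 - ((M - n : ℤ) : ℂ)) / 2) =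
      qpow τ (((n : ℂ) ^ 2 + n) / 2) * qpow τ (((M : ℂ) ^ 2 - M) / 2) := by
    rw [← qpow_add, ← qpow_add]; congr 1; push_cast; ring
  linear_combination (-1) ^ n * (-1) ^ M * this

/-- Expansion of `thetaSum / (1 - q^n y)` as a Laurent series in `y`. -/
lemma one_sub_mul_tsum_thetaPartial {τ : ℂ} (hτ : 0 < τ.im) (n : ℤ) (w : ℂ) :
    (1 - qpow τ n * qpow w 1) *
        ∑' M : ℤ, qpow τ (n * M) * thetaPartial τ (M - n) * qpow w M =
      (-1) ^ n * qpow τ (((n : ℂ) ^ 2 + n) / 2) * thetaSum w τ := by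
  have hs := summable_qpow_mul_thetaPartial hτ n w
  have hs' := hs.mul_left (qpow τ n * qpow w 1)
  have shift : ∑' M : ℤ, qpow τ n * qpow w 1 *
      (qpow τ (n * M) * thetaPartial τ (M - n) * qpow w M) =
      ∑' M : ℤ, qpow τ (n * M) * thetaPartial τ (M - n - 1) * qpow w M := by
    rw [← (Equiv.addRight (1 : ℤ)).tsum_eq fun M : ℤ ↦
      qpow τ (n * M) * thetaPartial τ (M - n - 1) * qpow w M]
    refine tsum_congr fun M ↦ ?_
    simp only [Equiv.coe_addRight, Int.cast_add, Int.cast_one, mul_add, qpow_add, mul_one]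
    rw [show M + 1 - n - 1 = M - n by ring]; ring
  have hs2 : Summable fun M : ℤ ↦
      qpow τ (n * M) * thetaPartial τ (M - n - 1) * qpow w M := by
    rw [← (Equiv.addRight (1 : ℤ)).summable_iff]
    refine hs'.congr fun M ↦ ?_
    simp only [Function.comp, Equiv.coe_addRight, Int.cast_add, Int.cast_one, mul_add, qpow_add,
      mul_one]
    rw [show M + 1 - n - 1 = M - n by ring]; ring
  rw [sub_mul, one_mul, ← tsum_mul_left, shift, ← hs.tsum_sub hs2, thetaSum, ← tsum_mul_left]
  refine tsum_congr fun M ↦ ?_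
  rw [← mul_assoc, ← thetaCoeff_mul_qpow, ← thetaPartial_sub hτ]
  ring

/-- Reindexing and negation of `tsum` need no summability, so neither does this. -/
lemma tsum_eq_zero_of_involution {f : ℤ → ℂ} (K : ℤ) (h : ∀ n, f (K - n) = -f n) :
    ∑' n, f n = 0 := by
  have h1 := (Equiv.subLeft K).tsum_eq f
  simp only [Equiv.subLeft_apply, h, tsum_neg] at h1
  linear_combination -(1 / 2 : ℂ) * h1

lemma thetaSum_zero (τ : ℂ) : thetaSum 0 τ = 0 := by
  refine tsum_eq_zero_of_involution 1 fun n ↦ ?_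
  rw [thetaCoeff_one_sub]; simp [qpow]

lemma neg_one_zpow_sub_of_odd {K : ℤ} (hK : Odd K) (n : ℤ) :
    (-1 : ℂ) ^ (K - n) = -(-1) ^ n := by
  rcases Int.even_or_odd n with hn | hn
  · rw [hn.neg_one_zpow, (hK.sub_even hn).neg_one_zpow]
  · rw [hn.neg_one_zpow, (hK.sub_odd hn).neg_one_zpow, neg_neg]

/-- Shifting n by one gives S = q^L (S - C), where C is the same sum with coefficients in place of
partial sums. A reflection shows C = 0, and q^L ≠ 1. -/
lemma tsum_qpow_mul_thetaPartial_sub {τ : ℂ} (hτ : 0 < τ.im) (L M : ℤ) (hL : L ≠ 0) :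
    ∑' n : ℤ, qpow τ (n * L) * thetaPartial τ (M - n) = 0 := by
  have hs : Summable fun n : ℤ ↦ qpow τ (n * L) * thetaPartial τ (M - n) := by
    have := (summable_prod_thetaPartial hτ (L - M) 0).comp_injective
      (i := fun n : ℤ ↦ (n, M)) (fun a b h ↦ by simpa using h)
    refine this.congr fun n ↦ ?_
    simp [qpow]
  set S := ∑' n : ℤ, qpow τ (n * L) * thetaPartial τ (M - n) with hS
  have hc : ∑' n : ℤ, qpow τ (n * L) * thetaCoeff τ (M - n) = 0 := by
    -- The exponent nL + ((M - n)² - (M - n))/2 is symmetric about n = M - L - 1/2; the reflection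
    -- changes parity, hence the sign.
    refine tsum_eq_zero_of_involution (2 * M - 2 * L - 1) fun n ↦ ?_
    rw [thetaCoeff, thetaCoeff, show M - (2 * M - 2 * L - 1 - n) = (2 * L + 1) - (M - n) by ring,
      neg_one_zpow_sub_of_odd (by simp)]
    have : qpow τ ((2 * M - 2 * L - 1 - n : ℤ) * L) *
        qpow τ ((((2 * L + 1 - (M - n) : ℤ) : ℂ) ^ 2 - ((2 * L + 1 - (M - n) : ℤ) : ℂ)) / 2) =
        qpow τ (n * L) * qpow τ ((((M - n : ℤ) : ℂ) ^ 2 - ((M - n : ℤ) : ℂ)) / 2) := by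
      rw [← qpow_add, ← qpow_add]; congr 1; push_cast; ring
    linear_combination -(-1) ^ (M - n) * this
  have h1 : S = qpow τ L *
      ∑' n : ℤ, qpow τ (n * L) * (thetaPartial τ (M - n) - thetaCoeff τ (M - n)) := by
    rw [hS, ← (Equiv.addRight (1 : ℤ)).tsum_eq, ← tsum_mul_left]
    refine tsum_congr fun n ↦ ?_
    have := thetaPartial_sub hτ (M - n)
    simp only [Equiv.coe_addRight, Int.cast_add, Int.cast_one, add_mul, qpow_add, one_mul]
    rw [show M - (n + 1) = M - n - 1 by ring]
    linear_combination -qpow τ (n * L) * qpow τ L * this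
  have hsc : Summable fun n : ℤ ↦ qpow τ (n * L) * thetaCoeff τ (M - n) := by
    have hs2 : Summable fun n : ℤ ↦ qpow τ (n * L) * thetaPartial τ (M - n - 1) := by
      rw [← (Equiv.subRight (1 : ℤ)).summable_iff]
      refine (hs.mul_left (qpow τ (-L))).congr fun n ↦ ?_
      simp only [Function.comp, Equiv.subRight_apply]
      rw [show M - (n - 1) - 1 = M - n by ring, ← mul_assoc, ← qpow_add]
      congr 2; push_cast; ring
    refine (hs.sub hs2).congr fun n ↦ ?_
    rw [← thetaPartial_sub hτ]; ring
  simp only [mul_sub] at h1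
  rw [hs.tsum_sub hsc, hc, sub_zero, ← hS] at h1
  have h2 : qpow τ L ≠ 1 := fun h ↦ hL ((qpow_int_eq_one_iff hτ L).mp h)
  have h3 : (1 - qpow τ L) * S = 0 := by linear_combination h1
  exact (mul_eq_zero.mp h3).resolve_left (sub_ne_zero.mpr h2.symm)

lemma div_mul_thetaSum_eq {τ : ℂ} (hτ : 0 < τ.im) (m n : ℤ) (w : ℂ)
    (hw : qpow τ n * qpow w 1 ≠ 1) :
    (-1) ^ n * qpow τ (((n : ℂ) ^ 2 + (2 * m + 1) * n) / 2) /
      (1 - qpow τ n * qpow w 1) * thetaSum w τ =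
      ∑' M : ℤ, qpow τ (n * (M + m)) * thetaPartial τ (M - n) * qpow w M := by
  have hne : 1 - qpow τ n * qpow w 1 ≠ 0 := sub_ne_zero.mpr hw.symm
  have h2 := one_sub_mul_tsum_thetaPartial hτ n w
  simp only [mul_add, qpow_add, mul_comm _ (qpow τ (n * m)), mul_assoc, tsum_mul_left] at h2 ⊢
  rw [show ((n : ℂ) ^ 2 + (2 * m + 1) * n) / 2 = ((n : ℂ) ^ 2 + n) / 2 + n * m by ring,
    qpow_add, div_mul_eq_mul_div, div_eq_iff hne]
  linear_combination -(qpow τ (n * m)) * h2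

/-- The partial fraction expansion of the reciprocal of the theta function. -/
theorem tsum_div_mul_thetaSum {τ : ℂ} (hτ : 0 < τ.im) (m : ℤ) (w : ℂ)
    (hw : ∀ n : ℤ, qpow τ n * qpow w 1 ≠ 1) :
    (∑' n : ℤ, (-1) ^ n * qpow τ (((n : ℂ) ^ 2 + (2 * m + 1) * n) / 2) /
      (1 - qpow τ n * qpow w 1)) * thetaSum w τ = qpow w (-m) * thetaNull τ := by
  have hs := summable_prod_thetaPartial hτ m w
  rw [← tsum_mul_right]
  simp only [fun n ↦ div_mul_thetaSum_eq hτ m n w (hw n)]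
  -- After the interchange the inner sum is the coefficient of y^M, which vanishes unless M = -m.
  rw [← Summable.tsum_comm (f := fun n M : ℤ ↦
    qpow τ (n * (M + m)) * thetaPartial τ (M - n) * qpow w M) hs, tsum_eq_single (-m)]
  · rw [tsum_mul_right, thetaNull, mul_comm]
    congr 1
    · push_cast; rfl
    · rw [← (Equiv.subLeft (-m)).tsum_eq]
      refine tsum_congr fun n ↦ ?_
      simp
  · intro M hM
    rw [tsum_mul_right]
    have := tsum_qpow_mul_thetaPartial_sub hτ (M + m) M (fun h ↦ hM (by linarith))
    push_cast at this
    rw [this, zero_mul]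

/-! ### The identity for a = 2 -/

lemma qpow_two_mul (τ x : ℂ) : qpow (2 * τ) x = qpow τ (2 * x) := by
  simp only [qpow]; ring_nf

lemma im_two_mul_pos {τ : ℂ} (hτ : 0 < τ.im) : 0 < (2 * τ).im := by simpa using hτ

/-- At 2τ the partial sums decay with exponent (M - n)², which again absorbs the cross term: -n²/2 +
2nM + (M - n)² = n²/2 + M². -/
lemma summable_prod_thetaPartial_two {τ : ℂ} (hτ : 0 < τ.im) (d : ℤ) (w : ℂ) :
    Summable fun p : ℤ × ℤ ↦ qpow τ (-(p.1 : ℂ) ^ 2 / 2 + d * p.1 / 2 + 2 * p.1 * p.2) *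
      thetaPartial (2 * τ) (p.2 - p.1) * qpow w p.2 := by
  have hpi := Real.pi_pos
  obtain ⟨C, hC, h⟩ := exists_norm_thetaPartial_le (im_two_mul_pos hτ)
  have h1 := summable_exp_quadratic (A := Real.pi * τ.im) (by positivity)
    (-(Real.pi * τ.im * d))
  have h2 := summable_exp_quadratic (A := 2 * Real.pi * τ.im) (by positivity)
    (-(2 * Real.pi * w.im))
  refine .of_norm_bounded ((h1.mul_of_nonneg h2 (fun _ ↦ by positivity)
    (fun _ ↦ by positivity)).mul_left C) fun p ↦ ?_
  obtain ⟨n, M⟩ := p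
  rw [norm_mul, norm_mul, norm_qpow_of_eq (y := (-n ^ 2 / 2 + d * n / 2 + 2 * n * M : ℝ))
      (by push_cast; ring), norm_qpow_of_eq (y := (M : ℝ)) (by simp)]
  calc _ ≤ Real.exp (-(2 * Real.pi * τ.im * (-n ^ 2 / 2 + d * n / 2 + 2 * n * M))) *
        (C * Real.exp (-(Real.pi * (2 * τ).im * (M - n : ℤ) ^ 2))) *
        Real.exp (-(2 * Real.pi * w.im * M)) := by gcongr; exact h _
    _ = _ := by
      dsimp only
      rw [mul_left_comm, mul_assoc, ← Real.exp_add, ← Real.exp_add, ← Real.exp_add]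
      simp only [Complex.mul_im, Complex.re_ofNat, Complex.im_ofNat]
      push_cast; ring_nf

lemma summable_gauss_mul_thetaPartial {τ : ℂ} (hτ : 0 < τ.im) (d M : ℤ) :
    Summable fun k : ℤ ↦ qpow τ (-(((k + M : ℤ) : ℂ) ^ 2 + d * (k + M : ℤ)) / 2) *
      thetaPartial (2 * τ) k := by
  have := ((summable_prod_thetaPartial_two hτ d 0).comp_injective
    (i := fun k : ℤ ↦ (M - k, M)) (fun a b h ↦ by simpa using h)).mul_left
      (qpow τ (-(2 * (M : ℂ) ^ 2 + d * M)))
  refine this.congr fun k ↦ ?_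
  simp only [Function.comp, sub_sub_cancel]
  rw [show qpow 0 (M : ℂ) = 1 by simp [qpow], mul_one, ← mul_assoc, ← qpow_add]
  congr 2; push_cast; ring

/-- Raising M by one amounts to shifting the argument of the partial sum. The difference is a sum
over theta coefficients that is odd under a reflection. -/
lemma tsum_gauss_mul_thetaPartial {τ : ℂ} (hτ : 0 < τ.im) {d : ℤ} (hd : Odd d) (M : ℤ) :
    ∑' k : ℤ, qpow τ (-(((k + M : ℤ) : ℂ) ^ 2 + d * (k + M : ℤ)) / 2) * thetaPartial (2 * τ) k =
      ∑' k : ℤ, qpow τ (-((k : ℂ) ^ 2 + d * k) / 2) * thetaPartial (2 * τ) k := by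
  set W : ℤ → ℂ := fun M ↦ ∑' k : ℤ,
    qpow τ (-(((k + M : ℤ) : ℂ) ^ 2 + d * (k + M : ℤ)) / 2) * thetaPartial (2 * τ) k with hW
  have step (M : ℤ) : W (M + 1) = W M := by
    have hs := summable_gauss_mul_thetaPartial hτ d M
    have hs' : Summable fun k : ℤ ↦ qpow τ (-(((k + M : ℤ) : ℂ) ^ 2 + d * (k + M : ℤ)) / 2) *
        thetaPartial (2 * τ) (k - 1) := by
      rw [← (Equiv.addRight (1 : ℤ)).summable_iff]
      refine (summable_gauss_mul_thetaPartial hτ d (M + 1)).congr fun k ↦ ?_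
      simp only [Function.comp, Equiv.coe_addRight, add_sub_cancel_right]
      rw [show k + 1 + M = k + (M + 1) by ring]
    have h1 : W (M + 1) = ∑' k : ℤ, qpow τ (-(((k + M : ℤ) : ℂ) ^ 2 + d * (k + M : ℤ)) / 2) *
        thetaPartial (2 * τ) (k - 1) := by
      rw [← (Equiv.addRight (1 : ℤ)).tsum_eq fun k : ℤ ↦
        qpow τ (-(((k + M : ℤ) : ℂ) ^ 2 + d * (k + M : ℤ)) / 2) * thetaPartial (2 * τ) (k - 1)]
      refine tsum_congr fun k ↦ ?_
      simp only [Equiv.coe_addRight, add_sub_cancel_right]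
      rw [show k + 1 + M = k + (M + 1) by ring]
    have h2 : W M - W (M + 1) = 0 := by
      rw [h1, hW]
      dsimp only
      rw [← hs.tsum_sub hs']
      simp only [← mul_sub, thetaPartial_sub (im_two_mul_pos hτ)]
      -- The quadratic exponent in k has its axis at k = M + 1 + d/2. The reflection flips the sign
      -- (-1)^k because d is odd.
      refine tsum_eq_zero_of_involution (2 + 2 * M + d) fun k ↦ ?_
      have hodd : Odd (2 + 2 * M + d) := by
        rw [show 2 + 2 * M + d = 2 * (1 + M) + d by ring]
        exact (even_two_mul _).add_odd hd
      rw [thetaCoeff, thetaCoeff, neg_one_zpow_sub_of_odd hodd, qpow_two_mul, qpow_two_mul]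
      have : qpow τ (-(((2 + 2 * M + d - k + M : ℤ) : ℂ) ^ 2 + d * (2 + 2 * M + d - k + M : ℤ)) / 2)
          * qpow τ (2 * ((((2 + 2 * M + d - k : ℤ) : ℂ) ^ 2 - (2 + 2 * M + d - k : ℤ)) / 2)) =
          qpow τ (-(((k + M : ℤ) : ℂ) ^ 2 + d * (k + M : ℤ)) / 2) *
            qpow τ (2 * (((k : ℂ) ^ 2 - k) / 2)) := by
        rw [← qpow_add, ← qpow_add]; congr 1; push_cast; ring
      linear_combination -(-1) ^ k * this
    linear_combination -h2
  have key : W M = W 0 := by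
    induction M using Int.induction_on with
    | zero => rfl
    | succ i ih => rw [step, ih]
    | pred i ih => rw [← ih, ← step, sub_add_cancel]
  simpa [hW] using key

/-- The numerator `∑_n q^(2 n² + d n) y^n`. -/
noncomputable def quadSum (d : ℤ) (w τ : ℂ) : ℂ :=
  ∑' n : ℤ, qpow τ (2 * (n : ℂ) ^ 2 + d * n) * qpow w n

/-- With k = M - n the exponent splits as 2M² + dM minus ((k + M)² + d(k + M))/2, and the sum over k
does not depend on M. -/
lemma tsum_prod_thetaPartial_two {τ : ℂ} (hτ : 0 < τ.im) {d : ℤ} (hd : Odd d) (w : ℂ) :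
    ∑' n : ℤ, ∑' M : ℤ, qpow τ (-(n : ℂ) ^ 2 / 2 + d * n / 2 + 2 * n * M) *
      thetaPartial (2 * τ) (M - n) * qpow w M =
    (∑' k : ℤ, qpow τ (-((k : ℂ) ^ 2 + d * k) / 2) * thetaPartial (2 * τ) k) *
      quadSum d w τ := by
  rw [← Summable.tsum_comm (f := fun n M : ℤ ↦
    qpow τ (-(n : ℂ) ^ 2 / 2 + d * n / 2 + 2 * n * M) *
      thetaPartial (2 * τ) (M - n) * qpow w M) (summable_prod_thetaPartial_two hτ d w),
    quadSum, ← tsum_mul_left]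
  refine tsum_congr fun M ↦ ?_
  rw [← mul_assoc, ← tsum_gauss_mul_thetaPartial hτ hd M, ← tsum_mul_right, ← tsum_mul_right,
    ← (Equiv.subLeft M).tsum_eq]
  refine tsum_congr fun k ↦ congrArg (· * qpow w M) ?_
  simp only [Equiv.subLeft_apply, sub_sub_cancel]
  rw [mul_right_comm _ (thetaPartial _ _), ← qpow_add]
  congr 2; push_cast; ring

lemma tsum_thetaPartial_two_eq {τ : ℂ} (hτ : 0 < τ.im) (d n : ℤ) (w : ℂ)
    (hw : qpow τ (2 * n) * qpow w 1 ≠ 1) :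
    ∑' M : ℤ, qpow τ (-(n : ℂ) ^ 2 / 2 + d * n / 2 + 2 * n * M) *
      thetaPartial (2 * τ) (M - n) * qpow w M =
    (-1) ^ n * qpow τ (((n : ℂ) ^ 2 + (d + 2) * n) / 2) / (1 - qpow τ (2 * n) * qpow w 1) *
      thetaSum w (2 * τ) := by
  have hne : 1 - qpow τ (2 * n) * qpow w 1 ≠ 0 := sub_ne_zero.mpr hw.symm
  have h2 := one_sub_mul_tsum_thetaPartial (im_two_mul_pos hτ) n w
  simp only [qpow_two_mul] at h2
  rw [div_mul_eq_mul_div, eq_div_iff hne]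
  have h3 (M : ℤ) : qpow τ (-(n : ℂ) ^ 2 / 2 + d * n / 2 + 2 * n * M) *
      thetaPartial (2 * τ) (M - n) * qpow w M = qpow τ (-(n : ℂ) ^ 2 / 2 + d * n / 2) *
      (qpow τ (2 * (n * M)) * thetaPartial (2 * τ) (M - n) * qpow w M) := by
    rw [qpow_add, ← mul_assoc (2 : ℂ)]; ring
  simp only [h3, tsum_mul_left]
  have h4 : qpow τ (((n : ℂ) ^ 2 + (d + 2) * n) / 2) =
      qpow τ (-(n : ℂ) ^ 2 / 2 + d * n / 2) * qpow τ (2 * (((n : ℂ) ^ 2 + n) / 2)) := by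
    rw [← qpow_add]; congr 1; ring
  rw [h4]
  linear_combination qpow τ (-(n : ℂ) ^ 2 / 2 + d * n / 2) * h2

lemma qpow_zero_left (x : ℂ) : qpow 0 x = 1 := by simp [qpow]

/-- Evaluation at y = 1 determines the constant. Rows with n ≠ 0 carry the factor θ(1) = 0; the row
n = 0, where 1 - y also vanishes, is read off directly from its Laurent series. -/
lemma tsum_mul_quadSum_zero {τ : ℂ} (hτ : 0 < τ.im) {d : ℤ} (hd : Odd d) :
    (∑' k : ℤ, qpow τ (-((k : ℂ) ^ 2 + d * k) / 2) * thetaPartial (2 * τ) k) *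
      quadSum d 0 τ = thetaNull (2 * τ) := by
  rw [← tsum_prod_thetaPartial_two hτ hd, tsum_eq_single 0]
  · simp [qpow_zero_left, thetaNull]
  · intro n hn
    rw [tsum_thetaPartial_two_eq hτ d n, thetaSum_zero, mul_zero]
    rw [qpow_zero_left, mul_one, ← qpow_two_mul]
    exact fun h ↦ hn ((qpow_int_eq_one_iff (im_two_mul_pos hτ) n).mp h)

theorem tsum_div_mul_thetaSum_two {τ : ℂ} (hτ : 0 < τ.im) {d : ℤ} (hd : Odd d) (w : ℂ)
    (hw : ∀ n : ℤ, qpow τ (2 * n) * qpow w 1 ≠ 1) :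
    (∑' n : ℤ, (-1) ^ n * qpow τ (((n : ℂ) ^ 2 + (d + 2) * n) / 2) /
      (1 - qpow τ (2 * n) * qpow w 1)) * thetaSum w (2 * τ) * quadSum d 0 τ =
      thetaNull (2 * τ) * quadSum d w τ := by
  have h := tsum_prod_thetaPartial_two hτ hd w
  simp only [fun n ↦ tsum_thetaPartial_two_eq hτ d n w (hw n), tsum_mul_right] at h
  rw [h, ← tsum_mul_quadSum_zero hτ hd]
  ring

/-! ### The q-binomial theorem and Jacobi's identity for the cube of Euler's product -/

/-- The finite product `(1 - q) ⋯ (1 - q^n)`. -/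
noncomputable def qFactorial (q : ℂ) (n : ℕ) : ℂ := ∏ i ∈ Finset.range n, (1 - q ^ (i + 1))

/-- The Gaussian binomial coefficients. -/
noncomputable def qChoose (q : ℂ) : ℕ → ℕ → ℂ
  | _, 0 => 1
  | 0, _ + 1 => 0
  | m + 1, j + 1 => qChoose q m (j + 1) + q ^ (m - j) * qChoose q m j

@[simp] lemma qChoose_zero_right (q : ℂ) (m : ℕ) : qChoose q m 0 = 1 := by
  cases m <;> rfl

lemma qChoose_succ_succ (q : ℂ) (m j : ℕ) :
    qChoose q (m + 1) (j + 1) = qChoose q m (j + 1) + q ^ (m - j) * qChoose q m j := by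
  rw [qChoose]

lemma qChoose_eq_zero (q : ℂ) {m j : ℕ} (h : m < j) : qChoose q m j = 0 := by
  induction m generalizing j with
  | zero => obtain ⟨j, rfl⟩ := Nat.exists_eq_succ_of_ne_zero h.ne'; rfl
  | succ m ih =>
    obtain ⟨j, rfl⟩ := Nat.exists_eq_succ_of_ne_zero (by omega : j ≠ 0)
    rw [Nat.succ_eq_add_one, qChoose_succ_succ, ih (by omega), ih (by omega)]; simp

lemma qFactorial_succ (q : ℂ) (n : ℕ) :
    qFactorial q (n + 1) = qFactorial q n * (1 - q ^ (n + 1)) := Finset.prod_range_succ _ _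

lemma qChoose_mul_qFactorial (q : ℂ) (j l : ℕ) :
    qChoose q (j + l) j * (qFactorial q j * qFactorial q l) = qFactorial q (j + l) := by
  obtain ⟨m, hm⟩ : ∃ m, m = j + l := ⟨_, rfl⟩
  rw [← hm]
  induction m generalizing j l with
  | zero =>
    obtain ⟨rfl, rfl⟩ : j = 0 ∧ l = 0 := by omega
    simp [qFactorial]
  | succ m ih =>
    rcases j with _ | j
    · obtain rfl : l = m + 1 := by omega
      simp [qFactorial]
    · rw [qChoose_succ_succ, qFactorial_succ q m]
      have h1 := ih j l (by omega)
      rcases l with _ | l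
      · obtain rfl : m = j := by omega
        rw [qChoose_eq_zero q (Nat.lt_succ_self m)]
        simp only [Nat.sub_self, pow_zero, one_mul, zero_add]
        rw [qFactorial_succ]
        linear_combination (1 - q ^ (m + 1)) * h1
      · have h2 := ih (j + 1) l (by omega)
        rw [show m - j = l + 1 by omega, qFactorial_succ q l]
        rw [qFactorial_succ q l] at h1
        rw [qFactorial_succ q j] at h2 ⊢
        have h3 : q ^ (m + 1) = q ^ (l + 1) * q ^ (j + 1) := by
          rw [← pow_add]; congr 1; omega
        rw [h3]
        linear_combination (1 - q ^ (l + 1)) * h2 + q ^ (l + 1) * (1 - q ^ (j + 1)) * h1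

/-- The `q`-binomial theorem. -/
lemma prod_one_sub_mul_pow (q x : ℂ) (m : ℕ) :
    ∏ k ∈ Finset.range m, (1 - x * q ^ k) =
      ∑ j ∈ Finset.range (m + 1), (-1) ^ j * qChoose q m j * q ^ j.choose 2 * x ^ j := by
  induction m with
  | zero => simp
  | succ m ih =>
    rw [Finset.prod_range_succ, ih, Finset.sum_range_succ' _ (m + 1)]
    have h (j : ℕ) (hj : j ∈ Finset.range (m + 1)) :
        (-1) ^ (j + 1) * qChoose q (m + 1) (j + 1) * q ^ (j + 1).choose 2 * x ^ (j + 1) =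
        (-1) ^ (j + 1) * qChoose q m (j + 1) * q ^ (j + 1).choose 2 * x ^ (j + 1) -
        ((-1) ^ j * qChoose q m j * q ^ j.choose 2 * x ^ j) * (x * q ^ m) := by
      have h1 : (j + 1).choose 2 = j.choose 2 + j := by
        rw [Nat.choose_succ_succ' j 1, Nat.choose_one_right, add_comm]
      have h2 : q ^ m = q ^ (m - j) * q ^ j := by
        rw [← pow_add]; congr 1
        have := Finset.mem_range.mp hj
        omega
      rw [qChoose_succ_succ, h1, h2]
      ring
    rw [Finset.sum_congr rfl h, Finset.sum_sub_distrib, ← Finset.sum_mul,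
      Finset.sum_range_succ (fun j ↦ (-1) ^ (j + 1) * qChoose q m (j + 1) *
        q ^ (j + 1).choose 2 * x ^ (j + 1)) m, qChoose_eq_zero q (Nat.lt_succ_self m)]
    have h0 := Finset.sum_range_succ' (fun j ↦ (-1) ^ j * qChoose q m j * q ^ j.choose 2 * x ^ j) m
    simp only [mul_zero, zero_mul, add_zero, pow_zero, qChoose_zero_right, Nat.choose_zero_succ,
      mul_one] at h0 ⊢
    linear_combination h0

lemma sum_range_add_one_eq_choose (N : ℕ) :
    ∑ i ∈ Finset.range N, (i + 1) = (N + 1).choose 2 := by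
  induction N with
  | zero => rfl
  | succ N ih => rw [Finset.sum_range_succ, ih, Nat.choose_succ_succ' (N + 1) 1,
      Nat.choose_one_right, add_comm]

/-- Apply x d/dx - N to the q-binomial theorem with 2N + 1 factors at x = q^(-N). The middle factor
vanishes there, so only its derivative survives, times the N factors on either side, each group
being a q-factorial up to a sign and a power of q. -/
lemma sum_mul_qChoose {q : ℂ} (hq : q ≠ 0) (N : ℕ) :
    ∑ j ∈ Finset.range (2 * N + 2), ((j : ℂ) - N) *
      ((-1) ^ j * qChoose q (2 * N + 1) j * q ^ j.choose 2 * (q ^ N)⁻¹ ^ j) =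
      -((-1) ^ N * (q ^ (N + 1).choose 2)⁻¹ * qFactorial q N ^ 2) := by
  have hqN : q ^ N ≠ 0 := pow_ne_zero _ hq
  set x₀ := (q ^ N)⁻¹ with hx₀
  set a : ℕ → ℂ := fun j ↦ (-1) ^ j * qChoose q (2 * N + 1) j * q ^ j.choose 2 with ha
  set g : ℂ → ℂ := fun x ↦ (∏ k ∈ Finset.range N, (1 - x * q ^ k)) *
    ∏ k ∈ Finset.range N, (1 - x * q ^ (N + 1 + k)) with hg
  have hf (x : ℂ) : ∑ j ∈ Finset.range (2 * N + 2), a j * x ^ j = (1 - x * q ^ N) * g x := by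
    rw [← prod_one_sub_mul_pow, show 2 * N + 1 = (N + 1) + N by ring, Finset.prod_range_add,
      Finset.prod_range_succ, hg]
    ring
  have hgd : DifferentiableAt ℂ g x₀ := by
    rw [hg]
    fun_prop
  have hd1 : HasDerivAt (fun x ↦ (1 - x * q ^ N) * g x)
      (-(q ^ N) * g x₀ + (1 - x₀ * q ^ N) * deriv g x₀) x₀ := by
    have h := ((hasDerivAt_id x₀).mul_const (q ^ N)).const_sub 1
    simpa using h.fun_mul hgd.hasDerivAt
  have hd2 : HasDerivAt (fun x ↦ ∑ j ∈ Finset.range (2 * N + 2), a j * x ^ j)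
      (∑ j ∈ Finset.range (2 * N + 2), a j * (j * x₀ ^ (j - 1))) x₀ := by
    refine HasDerivAt.fun_sum fun j _ ↦ ?_
    exact (hasDerivAt_pow j x₀).const_mul (a j)
  have hx1 : x₀ * q ^ N = 1 := inv_mul_cancel₀ hqN
  have key := hd2.unique ((funext hf : (fun x ↦ _) = _) ▸ hd1)
  rw [hx1, sub_self, zero_mul, add_zero] at key
  have hzero := hf x₀
  rw [hx1, sub_self, zero_mul] at hzero
  have hgx : g x₀ = (-1) ^ N * (q ^ (N + 1).choose 2)⁻¹ * qFactorial q N ^ 2 := by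
    have e1 : ∏ k ∈ Finset.range N, (1 - x₀ * q ^ (N + 1 + k)) = qFactorial q N := by
      refine Finset.prod_congr rfl fun k _ ↦ ?_
      rw [show N + 1 + k = N + (k + 1) by ring, pow_add, ← mul_assoc, hx1, one_mul]
    have e2 : ∏ k ∈ Finset.range N, (1 - x₀ * q ^ k) =
        (-1) ^ N * (q ^ (N + 1).choose 2)⁻¹ * qFactorial q N := by
      rw [← Finset.prod_range_reflect]
      have e3 (k : ℕ) (hk : k ∈ Finset.range N) : 1 - x₀ * q ^ (N - 1 - k) =
          (-1) * (q ^ (k + 1))⁻¹ * (1 - q ^ (k + 1)) := by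
        have hk' := Finset.mem_range.mp hk
        have e4 : q ^ N = q ^ (N - 1 - k) * q ^ (k + 1) := by
          rw [← pow_add]; congr 1; omega
        have h5 : q ^ (k + 1) ≠ 0 := pow_ne_zero _ hq
        have h6 : q ^ (N - 1 - k) ≠ 0 := pow_ne_zero _ hq
        rw [hx₀, e4]
        field_simp
        ring
      rw [Finset.prod_congr rfl e3, Finset.prod_mul_distrib, Finset.prod_mul_distrib, qFactorial,
        Finset.prod_const, Finset.card_range, Finset.prod_inv_distrib, Finset.prod_pow_eq_pow_sum,
        sum_range_add_one_eq_choose]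
    rw [hg]
    dsimp only
    rw [e1, e2]; ring
  calc _ = x₀ * ∑ j ∈ Finset.range (2 * N + 2), a j * (j * x₀ ^ (j - 1)) -
        N * ∑ j ∈ Finset.range (2 * N + 2), a j * x₀ ^ j := by
        rw [Finset.mul_sum, Finset.mul_sum, ← Finset.sum_sub_distrib]
        refine Finset.sum_congr rfl fun j _ ↦ ?_
        rcases j with _ | j
        · simp [ha]
        · simp only [ha, Nat.add_sub_cancel, pow_succ x₀]; ring
    _ = _ := by
        rw [key, hzero, hgx]
        linear_combination (-((-1) ^ N * (q ^ (N + 1).choose 2)⁻¹ * qFactorial q N ^ 2)) * hx1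

lemma eulerProd_ne_zero {q : ℂ} (hq : ‖q‖ < 1) : eulerProd q ≠ 0 := by
  have hs := (summable_nat_add_iff 1).mpr (summable_geometric_of_lt_one (norm_nonneg q) hq)
  have := tprod_one_add_ne_zero_of_summable (f := fun n : ℕ ↦ -q ^ (n + 1)) (fun n h ↦ ?_)
    (by simpa using hs)
  · simpa [eulerProd, sub_eq_add_neg] using this
  · have h1 : q ^ (n + 1) = 1 := by linear_combination -h
    have h2 := congrArg norm h1
    rw [norm_pow, norm_one] at h2
    exact (pow_lt_one₀ (norm_nonneg q) hq (Nat.succ_ne_zero n)).ne h2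

lemma tendsto_qFactorial {q : ℂ} (hq : ‖q‖ < 1) :
    Tendsto (qFactorial q) atTop (𝓝 (eulerProd q)) :=
  (ModularForm.multipliable_one_sub_pow hq).hasProd.tendsto_prod_nat

lemma qFactorial_ne_zero {q : ℂ} (hq : ‖q‖ < 1) (n : ℕ) : qFactorial q n ≠ 0 := by
  refine Finset.prod_ne_zero_iff.mpr fun i _ h ↦ ?_
  have h2 := congrArg norm (sub_eq_zero.mp h)
  rw [norm_pow, norm_one] at h2
  exact (pow_lt_one₀ (norm_nonneg q) hq (Nat.succ_ne_zero i)).ne h2.symm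

lemma qChoose_eq_div {q : ℂ} (hq : ‖q‖ < 1) (j l : ℕ) :
    qChoose q (j + l) j = qFactorial q (j + l) * (qFactorial q j)⁻¹ * (qFactorial q l)⁻¹ := by
  have h1 := qFactorial_ne_zero hq j
  have h2 := qFactorial_ne_zero hq l
  rw [← qChoose_mul_qFactorial]
  field_simp

/-- The uniform majorant for dominated convergence; q-factorials and their inverses converge, hence
are bounded. -/
lemma exists_norm_qChoose_le {q : ℂ} (hq : ‖q‖ < 1) :
    ∃ C : ℝ, 0 ≤ C ∧ ∀ m j : ℕ, ‖qChoose q m j‖ ≤ C := by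
  obtain ⟨A, hA⟩ := (tendsto_qFactorial hq).norm.bddAbove_range
  obtain ⟨B, hB⟩ := ((tendsto_qFactorial hq).inv₀ (eulerProd_ne_zero hq)).norm.bddAbove_range
  have hA' (n : ℕ) : ‖qFactorial q n‖ ≤ A := hA ⟨n, rfl⟩
  have hB' (n : ℕ) : ‖(qFactorial q n)⁻¹‖ ≤ B := hB ⟨n, rfl⟩
  have hA0 : 0 ≤ A := (norm_nonneg _).trans (hA' 0)
  have hB0 : 0 ≤ B := (norm_nonneg _).trans (hB' 0)
  refine ⟨A * B * B, by positivity, fun m j ↦ ?_⟩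
  rcases lt_or_ge m j with h | h
  · rw [qChoose_eq_zero q h, norm_zero]; positivity
  · obtain ⟨l, rfl⟩ := Nat.exists_eq_add_of_le h
    rw [qChoose_eq_div hq, norm_mul, norm_mul]
    gcongr
    exacts [hA' _, hB' _, hB' _]

lemma norm_qpow_one_lt_one {τ : ℂ} (hτ : 0 < τ.im) : ‖qpow τ 1‖ < 1 := by
  have hpi := Real.pi_pos
  have : 0 < 2 * Real.pi * τ.im := by positivity
  rw [norm_qpow_of_eq (y := 1) (by simp), Real.exp_lt_one_iff]
  linarith

lemma qpow_one_pow (τ : ℂ) (n : ℕ) : qpow τ 1 ^ n = qpow τ n := by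
  rw [qpow, qpow, ← Complex.exp_nat_mul]; ring_nf

lemma natCast_choose_two (n : ℕ) : ((n.choose 2 : ℕ) : ℂ) = ((n : ℂ) ^ 2 - n) / 2 := by
  rw [Nat.cast_choose_two]; ring

/-- The finite form of Jacobi's identity for the cube of Euler's product. -/
lemma tsum_mul_qChoose_mul_thetaCoeff (τ : ℂ) (N : ℕ) :
    ∑' n : ℤ, (if 0 ≤ n + N then qChoose (qpow τ 1) (2 * N + 1) (n + N).toNat else 0) *
      (n * thetaCoeff τ n) = -qFactorial (qpow τ 1) N ^ 2 := by
  set q := qpow τ 1 with hq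
  have hq0 : q ≠ 0 := qpow_ne_zero _ _
  set h : ℤ → ℂ := fun n ↦ (if 0 ≤ n + N then qChoose q (2 * N + 1) (n + N).toNat else 0) *
      (n * thetaCoeff τ n) with hh
  -- Substituting n = j - N turns the sum into one over 0 ≤ j ≤ 2N + 1, outside which the Gaussian
  -- binomials or the cut-off vanish.
  rw [← (Equiv.subRight (N : ℤ)).tsum_eq h,
    ← (Nat.cast_injective (R := ℤ)).tsum_eq (f := fun c ↦ h (Equiv.subRight (N : ℤ) c)) ?_]
  swap
  · intro c hc
    by_contra hcon
    refine hc ?_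
    have : ¬ 0 ≤ c := fun h0 ↦ hcon ⟨c.toNat, Int.toNat_of_nonneg h0⟩
    simp [hh, this]
  rw [tsum_eq_sum (s := Finset.range (2 * N + 2))]
  swap
  · intro j hj
    have : 2 * N + 1 < j := by
      have := Finset.mem_range.not.mp hj
      omega
    simp [hh, qChoose_eq_zero q this]
  have key := sum_mul_qChoose hq0 N
  have e1 : (q ^ (N + 1).choose 2) ≠ 0 := pow_ne_zero _ hq0
  have e2 : ∑ j ∈ Finset.range (2 * N + 2), h (Equiv.subRight (N : ℤ) (j : ℤ)) =
      (-1) ^ N * q ^ (N + 1).choose 2 * ∑ j ∈ Finset.range (2 * N + 2), ((j : ℂ) - N) *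
      ((-1) ^ j * qChoose q (2 * N + 1) j * q ^ j.choose 2 * (q ^ N)⁻¹ ^ j) := by
    rw [Finset.mul_sum]
    refine Finset.sum_congr rfl fun j _ ↦ ?_
    have e3 : (-1 : ℂ) ^ ((j : ℤ) - N) = (-1) ^ N * (-1) ^ j := by
      rw [zpow_sub₀ (by norm_num), zpow_natCast, zpow_natCast, div_eq_mul_inv, mul_comm,
        ← inv_pow]; norm_num
    have e4 : qpow τ (((((j : ℤ) - N : ℤ) : ℂ) ^ 2 - ((j : ℤ) - N : ℤ)) / 2) =
        q ^ (N + 1).choose 2 * q ^ j.choose 2 * (q ^ N)⁻¹ ^ j := by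
      rw [inv_pow, ← pow_mul, hq, qpow_one_pow, qpow_one_pow, qpow_one_pow, ← qpow_neg, ← qpow_add,
        ← qpow_add, natCast_choose_two, natCast_choose_two]
      congr 1; push_cast; ring
    simp only [hh, Equiv.subRight_apply, thetaCoeff, e3, e4]
    simp
    ring
  rw [e2, key]
  have e5 : ((-1 : ℂ) ^ N) * (-1) ^ N = 1 := by rw [← mul_pow]; simp
  field_simp
  linear_combination -qFactorial q N ^ 2 * e5

/-- As N → ∞ each Gaussian binomial tends to 1/φ(q), so the finite identity becomes φ(q)⁻¹ ∑ n
(-1)^n q^(n(n-1)/2) = -φ(q)². -/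
theorem thetaNull_eq_eulerProd {τ : ℂ} (hτ : 0 < τ.im) :
    thetaNull τ = eulerProd (qpow τ 1) ^ 3 := by
  set q := qpow τ 1 with hqdef
  have hq : ‖q‖ < 1 := norm_qpow_one_lt_one hτ
  have hφ := eulerProd_ne_zero hq
  obtain ⟨C, hC0, hC⟩ := exists_norm_qChoose_le hq
  have hsum : Summable fun n : ℤ ↦ (n : ℂ) * thetaCoeff τ n := by
    simpa [qpow_zero_left] using summable_pow_mul_thetaCoeff hτ 0 1
  have ht := tendsto_qFactorial hq
  have lim : Tendsto (fun N : ℕ ↦ ∑' n : ℤ,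
      (if 0 ≤ n + N then qChoose q (2 * N + 1) (n + N).toNat else 0) * (n * thetaCoeff τ n)) atTop
      (𝓝 (∑' n : ℤ, (eulerProd q)⁻¹ * (n * thetaCoeff τ n))) := by
    refine tendsto_tsum_of_dominated_convergence (hsum.norm.mul_left C) (fun n ↦ ?_)
      (Eventually.of_forall fun N n ↦ ?_)
    · refine Tendsto.mul_const _ ?_
      have hlim : Tendsto (fun N : ℕ ↦ qFactorial q (2 * N + 1) *
          (qFactorial q (n + N).toNat)⁻¹ * (qFactorial q (1 - n + N).toNat)⁻¹) atTop
          (𝓝 (eulerProd q * (eulerProd q)⁻¹ * (eulerProd q)⁻¹)) := by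
        have hN (b : ℤ) : Tendsto (fun N : ℕ ↦ (b + N).toNat) atTop atTop :=
          tendsto_atTop.mpr fun c ↦ by
            filter_upwards [eventually_ge_atTop (c + b.natAbs)] with N hN
            omega
        refine ((ht.comp ?_).mul ((ht.comp (hN n)).inv₀ hφ)).mul ((ht.comp (hN (1 - n))).inv₀ hφ)
        exact tendsto_atTop.mpr fun c ↦ by
          filter_upwards [eventually_ge_atTop c] with N hN
          omega
      rw [mul_inv_cancel₀ hφ, one_mul] at hlim
      refine hlim.congr' ?_
      filter_upwards [eventually_ge_atTop (n.natAbs + 1)] with N hN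
      rw [if_pos (by omega), show 2 * N + 1 = (n + N).toNat + (1 - n + N).toNat by omega,
        qChoose_eq_div hq]
    · rw [norm_mul]
      gcongr
      split_ifs
      · exact hC _ _
      · simpa using hC0
  simp only [hqdef, tsum_mul_qChoose_mul_thetaCoeff] at lim
  have h2 := tendsto_nhds_unique lim (ht.pow 2).neg
  rw [tsum_mul_left, ← hqdef] at h2
  rw [thetaNull_eq hτ]
  field_simp at h2
  linear_combination -h2

/-! ### Joint analyticity of the theta function -/

section ExpSeries

variable {E : Type*} [NormedAddCommGroup E] [NormedSpace ℂ E] {ι : Type*}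

/-- A series of exponentials of linear forms is analytic where it converges well enough. -/
lemma analyticAt_tsum_mul_exp (c : ι → ℂ) (L : ι → E →L[ℂ] ℂ) {r : ℝ} (hr : 0 < r)
    (h : Summable fun i ↦ ‖c i‖ * Real.exp (‖L i‖ * r)) :
    AnalyticAt ℂ (fun x ↦ ∑' i, c i * cexp (L i x)) 0 := by
  let p (i : ι) : FormalMultilinearSeries ℂ E ℂ :=
    (NormedSpace.expSeries ℂ ℂ).compContinuousLinearMap (L i)
  have hp (i : ι) (k : ℕ) : ‖p i k‖ ≤ ‖L i‖ ^ k / k.factorial := by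
    refine ((NormedSpace.expSeries ℂ ℂ).norm_compContinuousLinearMap_le (L i) k).trans ?_
    have : ‖NormedSpace.expSeries ℂ ℂ k‖ ≤ 1 / k.factorial := by
      rw [NormedSpace.expSeries, norm_smul]
      simp [ContinuousMultilinearMap.norm_mkPiAlgebraFin]
    calc _ ≤ 1 / (k.factorial : ℝ) * ‖L i‖ ^ k := by gcongr
      _ = _ := by ring
  have hexp (t : ℝ) : HasSum (fun k : ℕ ↦ t ^ k / k.factorial) (Real.exp t) := by
    rw [Real.exp_eq_exp_ℝ]
    exact NormedSpace.expSeries_div_hasSum_exp t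
  have hpow (x : E) (i : ι) : HasSum (fun k : ℕ ↦ p i k fun _ ↦ x) (cexp (L i x)) := by
    rw [Complex.exp_eq_exp_ℂ]
    exact NormedSpace.expSeries_hasSum_exp (𝕂 := ℂ) (L i x)
  -- Expanding every exponential gives an absolutely convergent double series; summing first over ι
  -- yields the homogeneous terms of the power series.
  have hdouble : Summable fun x : ι × ℕ ↦ ‖c x.1‖ * (‖L x.1‖ * r) ^ x.2 / x.2.factorial := by
    rw [summable_prod_of_nonneg (fun _ ↦ by positivity)]
    refine ⟨fun i ↦ ?_, ?_⟩
    · simpa [mul_div_assoc] using (hexp (‖L i‖ * r)).summable.mul_left ‖c i‖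
    · refine h.congr fun i ↦ ?_
      simp only [mul_div_assoc]
      rw [tsum_mul_left, (hexp _).tsum_eq]
  have hnorm (i : ι) (k : ℕ) : ‖c i • p i k‖ * r ^ k ≤ ‖c i‖ * (‖L i‖ * r) ^ k / k.factorial := by
    rw [norm_smul, mul_pow]
    calc _ ≤ ‖c i‖ * (‖L i‖ ^ k / k.factorial) * r ^ k := by gcongr; exact hp i k
      _ = _ := by ring
  have hsk (k : ℕ) : Summable fun i ↦ ‖c i • p i k‖ := by
    have := (hdouble.comp_injective (i := fun i : ι ↦ (i, k))
      (fun a b h ↦ by simpa using h)).div_const (r ^ k)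
    refine this.of_nonneg_of_le (fun _ ↦ norm_nonneg _) fun i ↦ ?_
    rw [le_div_iff₀ (by positivity)]
    exact hnorm i k
  let P : FormalMultilinearSeries ℂ E ℂ := fun k ↦ ∑' i, c i • p i k
  have hswap : Summable fun y : ℕ × ι ↦ ‖c y.2‖ * (‖L y.2‖ * r) ^ y.1 / y.1.factorial :=
    hdouble.prod_symm
  refine HasFPowerSeriesAt.analyticAt (p := P) ⟨ENNReal.ofReal r, ?_, by simpa using hr, ?_⟩
  · refine P.le_radius_of_bound (∑' k : ℕ, ∑' i, ‖c i‖ * (‖L i‖ * r) ^ k / k.factorial)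
      (r := r.toNNReal) fun k ↦ ?_
    rw [Real.coe_toNNReal r hr.le]
    calc ‖P k‖ * r ^ k ≤ (∑' i, ‖c i • p i k‖) * r ^ k := by
          gcongr; exact norm_tsum_le_tsum_norm (hsk k)
      _ = ∑' i, ‖c i • p i k‖ * r ^ k := tsum_mul_right.symm
      _ ≤ ∑' i, ‖c i‖ * (‖L i‖ * r) ^ k / k.factorial :=
          ((hsk k).mul_right _).tsum_le_tsum (hnorm · k) (hswap.prod_factor k)
      _ ≤ ∑' k : ℕ, ∑' i, ‖c i‖ * (‖L i‖ * r) ^ k / k.factorial :=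
          hswap.prod.le_tsum k fun _ _ ↦ tsum_nonneg fun _ ↦ by positivity
  · intro x hx
    rw [zero_add]
    have hxr : ‖x‖ ≤ r := by
      rw [Metric.eball_ofReal, mem_ball_zero_iff] at hx
      exact hx.le
    have hfam : Summable fun y : ℕ × ι ↦ (c y.2 • p y.2 y.1) fun _ ↦ x := by
      refine hswap.of_norm_bounded fun y ↦ ?_
      refine ((c y.2 • p y.2 y.1).le_opNorm _).trans ?_
      simp only [Finset.prod_const, Finset.card_univ, Fintype.card_fin]
      exact le_trans (by gcongr) (hnorm y.2 y.1)
    have h1 (k : ℕ) : (P k fun _ ↦ x) = ∑' i, (c i • p i k) fun _ ↦ x :=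
      ContinuousMultilinearMap.tsum_eval (hsk k).of_norm _
    have h3 : ∑' i, c i * cexp (L i x) = ∑' k, ∑' i, (c i • p i k) fun _ ↦ x := by
      refine (tsum_congr fun i ↦ ?_).trans
        (Summable.tsum_comm (f := fun k i ↦ (c i • p i k) fun _ ↦ x) hfam)
      exact ((hpow x i).mul_left (c i)).tsum_eq.symm
    simp only [h1, h3]
    exact hfam.prod.hasSum

end ExpSeries

lemma analyticAt_thetaSum {w τ : ℂ} (hτ : 0 < τ.im) :
    AnalyticAt ℂ (fun p : ℂ × ℂ ↦ thetaSum p.1 p.2) (w, τ) := by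
  have hpi := Real.pi_pos
  let L (n : ℤ) : ℂ × ℂ →L[ℂ] ℂ := (2 * Real.pi * I * n) • ContinuousLinearMap.fst ℂ ℂ ℂ +
    (2 * Real.pi * I * (((n : ℂ) ^ 2 - n) / 2)) • ContinuousLinearMap.snd ℂ ℂ ℂ
  have hL (n : ℤ) : ‖L n‖ ≤ 4 * Real.pi * n ^ 2 := by
    have h1 : |(n : ℝ)| ≤ (n : ℝ) ^ 2 := by
      rcases eq_or_ne n 0 with rfl | hn
      · simp
      · have : (1 : ℝ) ≤ |(n : ℝ)| := by exact_mod_cast Int.one_le_abs hn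
        rw [← sq_abs]
        nlinarith
    have h2 : ‖((n : ℂ) ^ 2 - n) / 2‖ ≤ (n : ℝ) ^ 2 := by
      rw [norm_div, Complex.norm_ofNat, div_le_iff₀ two_pos]
      refine (norm_sub_le _ _).trans ?_
      rw [norm_pow, Complex.norm_intCast, sq_abs]
      linarith
    have h3 : ‖(2 * Real.pi * I : ℂ)‖ = 2 * Real.pi := by simp [abs_of_pos hpi]
    calc ‖L n‖ ≤ ‖(2 * Real.pi * I * n : ℂ)‖ * 1 +
          ‖(2 * Real.pi * I * (((n : ℂ) ^ 2 - n) / 2) : ℂ)‖ * 1 := by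
          refine (norm_add_le _ _).trans ?_
          rw [norm_smul, norm_smul]
          gcongr
          exacts [ContinuousLinearMap.norm_fst_le .., ContinuousLinearMap.norm_snd_le ..]
      _ ≤ 2 * Real.pi * n ^ 2 + 2 * Real.pi * n ^ 2 := by
          rw [mul_one, mul_one, norm_mul, norm_mul (2 * Real.pi * I : ℂ), h3, Complex.norm_intCast]
          gcongr
      _ = _ := by ring
  -- Recentred at (w, τ), each term is its value there times the exponential of `L n`. Since ‖L n‖ ≤
  -- 4πn², radius im(τ)/8 consumes only half of the Gaussian decay.
  have key := analyticAt_tsum_mul_exp (fun n : ℤ ↦ thetaCoeff τ n * qpow w n) L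
    (r := τ.im / 8) (by positivity) ?_
  · have hsub : AnalyticAt ℂ (fun p : ℂ × ℂ ↦ p - (w, τ)) (w, τ) := by fun_prop
    have := AnalyticAt.comp_of_eq key hsub (by simp)
    refine this.congr (.of_forall fun p ↦ tsum_congr fun n ↦ ?_)
    simp only [L, thetaCoeff, qpow, mul_assoc, ← Complex.exp_add]
    simp
    left
    ring_nf
  · refine .of_nonneg_of_le (fun _ ↦ by positivity) (fun n ↦ ?_)
      (summable_exp_quadratic (A := Real.pi * τ.im / 2) (by positivity)
        (Real.pi * τ.im - 2 * Real.pi * w.im))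
    rw [norm_mul, norm_thetaCoeff, norm_qpow_of_eq (y := (n : ℝ)) (by simp), ← Real.exp_add,
      ← Real.exp_add, Real.exp_le_exp]
    have := mul_le_mul_of_nonneg_right (hL n) (by positivity : 0 ≤ τ.im / 8)
    linarith

/-! ### Elliptic and modular transformations of the reciprocal theta function -/

lemma thetaSum_eq_jacobiTheta₂ (w τ : ℂ) :
    thetaSum w τ = jacobiTheta₂ (w + 1 / 2 - τ / 2) τ := by
  refine tsum_congr fun n ↦ ?_
  have h1 : (-1 : ℂ) ^ n = cexp (Real.pi * I * n) := by
    rw [← Complex.exp_pi_mul_I, ← Complex.exp_int_mul]; ring_nf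
  rw [thetaCoeff, h1, qpow, qpow, jacobiTheta₂_term, ← Complex.exp_add, ← Complex.exp_add]
  ring_nf

lemma thetaNull_eq_jacobiTheta₂' {τ : ℂ} (hτ : 0 < τ.im) :
    jacobiTheta₂' (1 / 2 - τ / 2) τ = -(2 * Real.pi * I) * thetaNull τ := by
  rw [thetaNull_eq hτ, neg_mul_neg, ← tsum_mul_left]
  refine tsum_congr fun n ↦ ?_
  have h1 : (-1 : ℂ) ^ n = cexp (Real.pi * I * n) := by
    rw [← Complex.exp_pi_mul_I, ← Complex.exp_int_mul]; ring_nf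
  rw [jacobiTheta₂'_term, thetaCoeff, h1, qpow, jacobiTheta₂_term, ← Complex.exp_add, mul_assoc]
  ring_nf

lemma hasDerivAt_thetaSum_zero {τ : ℂ} (hτ : 0 < τ.im) :
    HasDerivAt (fun w ↦ thetaSum w τ) (-(2 * Real.pi * I) * thetaNull τ) 0 := by
  rw [← thetaNull_eq_jacobiTheta₂' hτ]
  simp only [thetaSum_eq_jacobiTheta₂, add_sub_assoc]
  refine HasDerivAt.comp_add_const (f := fun z ↦ jacobiTheta₂ z τ) 0 (1 / 2 - τ / 2) ?_
  rw [zero_add]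
  exact hasDerivAt_jacobiTheta₂_fst _ hτ

lemma im_neg_one_div_pos {τ : ℂ} (hτ : 0 < τ.im) : 0 < (-1 / τ).im := by
  have h0 : τ ≠ 0 := fun h ↦ by simp [h] at hτ
  rw [neg_div, one_div, neg_im, inv_im, neg_div, neg_neg]
  exact div_pos hτ (normSq_pos.mpr h0)

/-- Only the independence of K from w matters: K cancels in the quotient `recipTheta`. -/
lemma exists_thetaSum_S {τ : ℂ} (hτ : 0 < τ.im) : ∃ K : ℂ, K ≠ 0 ∧ ∀ w : ℂ,
    thetaSum (w / τ) (-1 / τ) =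
      K * cexp (Real.pi * I * (w ^ 2 / τ + w / τ - w)) * thetaSum w τ := by
  have h0 : τ ≠ 0 := fun h ↦ by simp [h] at hτ
  have hc : (-I * τ) ^ (1 / 2 : ℂ) ≠ 0 := by
    rw [Complex.cpow_ne_zero_iff_of_exponent_ne_zero (by norm_num)]
    simp [h0]
  refine ⟨-(-I * τ) ^ (1 / 2 : ℂ) * cexp (Real.pi * I * ((1 + τ) ^ 2 / (4 * τ))),
    mul_ne_zero (neg_ne_zero.mpr hc) (Complex.exp_ne_zero _), fun w ↦ ?_⟩
  -- Dividing this argument by τ gives w/τ + 1/2 + 1/(2τ), the shift that belongs to -1/τ; one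
  -- quasi-period brings w + 1/2 + τ/2 back to w + 1/2 - τ/2.
  have h1 := jacobiTheta₂_functional_equation (w + 1 / 2 + τ / 2) τ
  have h2 := jacobiTheta₂_add_left' (w + 1 / 2 - τ / 2) τ
  rw [thetaSum_eq_jacobiTheta₂, thetaSum_eq_jacobiTheta₂ w]
  rw [show w + 1 / 2 - τ / 2 + τ = w + 1 / 2 + τ / 2 by ring] at h2
  rw [h2, show (w + 1 / 2 + τ / 2) / τ = w / τ + 1 / 2 - -1 / τ / 2 by field_simp; ring] at h1
  set X := jacobiTheta₂ (w / τ + 1 / 2 - -1 / τ / 2) (-1 / τ)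
  set Y := jacobiTheta₂ (w + 1 / 2 - τ / 2) τ
  have e1 : cexp (-Real.pi * I * (τ + 2 * (w + 1 / 2 - τ / 2))) = -cexp (-(2 * Real.pi * I * w)) := by
    rw [show -Real.pi * I * (τ + 2 * (w + 1 / 2 - τ / 2)) =
      -(2 * Real.pi * I * w) + -(Real.pi * I) by ring, Complex.exp_add, Complex.exp_neg (_ * I),
      Complex.exp_pi_mul_I]
    norm_num
  rw [e1] at h1
  have e2 : cexp (-Real.pi * I * (w + 1 / 2 + τ / 2) ^ 2 / τ) ≠ 0 := Complex.exp_ne_zero _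
  have e3 : cexp (-(2 * Real.pi * I * w)) = cexp (-Real.pi * I * (w + 1 / 2 + τ / 2) ^ 2 / τ) *
      (cexp (Real.pi * I * ((1 + τ) ^ 2 / (4 * τ))) *
        cexp (Real.pi * I * (w ^ 2 / τ + w / τ - w))) := by
    rw [← Complex.exp_add, ← Complex.exp_add]
    congr 1
    field_simp
    ring
  rw [e3] at h1
  set c := (-I * τ) ^ (1 / 2 : ℂ)
  set A := cexp (Real.pi * I * ((1 + τ) ^ 2 / (4 * τ)))
  set B := cexp (Real.pi * I * (w ^ 2 / τ + w / τ - w))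
  set D := cexp (-Real.pi * I * (w + 1 / 2 + τ / 2) ^ 2 / τ)
  have hcc : c * (1 / c) = 1 := mul_one_div_cancel hc
  have h4 : D * (X + c * A * B * Y) = 0 := by linear_combination (-c) * h1 - D * X * hcc
  linear_combination (mul_eq_zero.mp h4).resolve_left e2

/-- The weight one meromorphic Jacobi form of index `-1 / 2` on the full modular group. -/
noncomputable def recipTheta (w τ : ℂ) : ℂ := qpow w (1 / 2) * thetaNull τ / thetaSum w τ

lemma thetaSum_add (w τ : ℂ) (v l : ℤ) :
    thetaSum (w + v * τ + l) τ =
      (-1) ^ v * qpow τ (((v : ℂ) - v ^ 2) / 2) * qpow w (-v) * thetaSum w τ := by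
  rw [thetaSum, thetaSum, ← (Equiv.subRight v).tsum_eq, ← tsum_mul_left]
  refine tsum_congr fun n ↦ ?_
  have h1 : (-1 : ℂ) ^ (n - v) = (-1) ^ v * (-1) ^ n := by
    rw [zpow_sub₀ (by norm_num), div_eq_mul_inv, mul_comm, ← inv_zpow]; norm_num
  have h2 : qpow (l : ℂ) ((n - v : ℤ) : ℂ) = 1 := by
    rw [qpow, mul_assoc, ← Int.cast_mul, mul_comm]
    exact Complex.exp_int_mul_two_pi_mul_I _
  have h3 : qpow ((v : ℂ) * τ) ((n - v : ℤ) : ℂ) = qpow τ (v * (n - v : ℤ)) := by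
    simp only [qpow]; ring_nf
  simp only [Equiv.subRight_apply, qpow_add_left, h2, h3, thetaCoeff, h1]
  have h4 : qpow τ ((((n - v : ℤ) : ℂ) ^ 2 - (n - v : ℤ)) / 2) * qpow τ (v * (n - v : ℤ)) =
      qpow τ (((v : ℂ) - v ^ 2) / 2) * qpow τ (((n : ℂ) ^ 2 - n) / 2) := by
    rw [← qpow_add, ← qpow_add]; congr 1; push_cast; ring
  have h5 : qpow w ((n - v : ℤ) : ℂ) = qpow w (-v) * qpow w n := by
    rw [← qpow_add]; congr 1; push_cast; ring
  rw [h5]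
  linear_combination (-1) ^ v * (-1) ^ n * qpow w (-v) * qpow w n * h4

lemma qpow_int_half (l : ℤ) : qpow (l : ℂ) (1 / 2) = (-1) ^ l := by
  rw [← Complex.exp_pi_mul_I, ← Complex.exp_int_mul, qpow]; ring_nf

lemma recipTheta_add (w τ : ℂ) (v l : ℤ) :
    recipTheta (w + v * τ + l) τ =
      (-1) ^ (v + l) * qpow τ ((v : ℂ) ^ 2 / 2) * qpow w v * recipTheta w τ := by
  have h1 : qpow ((v : ℂ) * τ) (1 / 2) =
      qpow τ ((v : ℂ) ^ 2 / 2) * qpow τ (((v : ℂ) - v ^ 2) / 2) := by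
    rw [← qpow_add]; simp only [qpow]; ring_nf
  have h2 := qpow_ne_zero τ (((v : ℂ) - v ^ 2) / 2)
  have h3 := qpow_ne_zero w v
  have h4 : ((-1 : ℂ) ^ v) ≠ 0 := zpow_ne_zero _ (by norm_num)
  have h5 : ((-1 : ℂ) ^ v) * (-1) ^ v = 1 := by rw [← mul_zpow]; simp
  rw [recipTheta, recipTheta, thetaSum_add, qpow_add_left, qpow_add_left, h1, qpow_int_half,
    qpow_neg, zpow_add₀ (by norm_num)]
  -- At a zero of theta both sides are 0 by the convention for division, so the law holds at every
  -- w.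
  rcases eq_or_ne (thetaSum w τ) 0 with h0 | h0
  · simp [h0]
  · generalize qpow τ (((v : ℂ) - v ^ 2) / 2) = a at h2 ⊢
    field_simp
    linear_combination -(qpow w (1 / 2) * qpow τ ((v : ℂ) ^ 2 / 2) * thetaNull τ) * h5

lemma recipTheta_T (w τ : ℂ) : recipTheta w (τ + 1) = recipTheta w τ := by
  have h (n : ℤ) : thetaCoeff (τ + 1) n = thetaCoeff τ n := by
    obtain ⟨k, hk⟩ : (2 : ℤ) ∣ n ^ 2 - n := by
      rw [show n ^ 2 - n = n * (n - 1) by ring]; exact (Int.even_mul_pred_self n).two_dvd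
    have hk' : ((n : ℂ) ^ 2 - n) / 2 = k := by
      have : ((n : ℂ) ^ 2 - n) = 2 * k := by exact_mod_cast hk
      rw [this]; ring
    rw [thetaCoeff, thetaCoeff, hk', qpow_add_left, qpow, qpow, mul_one, mul_comm _ (k : ℂ),
      mul_comm (2 * Real.pi * I) (k : ℂ), Complex.exp_int_mul_two_pi_mul_I, mul_one]
  simp only [recipTheta, thetaNull, thetaPartial, thetaSum, h]

/-- Differentiating the law of theta at its zero w = 0 gives `thetaNull (-1 / τ) = τ * K * thetaNull
τ`. In the quotient K cancels and the factor τ, that is weight one, remains. -/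
lemma recipTheta_S {τ : ℂ} (hτ : 0 < τ.im) (w : ℂ) :
    recipTheta (w / τ) (-1 / τ) = τ * cexp (-(Real.pi * I * (w ^ 2 / τ))) * recipTheta w τ := by
  have h0 : τ ≠ 0 := fun h ↦ by simp [h] at hτ
  obtain ⟨K, hK, h⟩ := exists_thetaSum_S hτ
  have hpi : (2 * Real.pi * I : ℂ) ≠ 0 := by simp [Real.pi_ne_zero]
  have hnull : thetaNull (-1 / τ) = τ * K * thetaNull τ := by
    have d1 : HasDerivAt (fun w ↦ thetaSum (w / τ) (-1 / τ))
        (-(2 * Real.pi * I) * thetaNull (-1 / τ) * (1 / τ)) 0 := by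
      refine HasDerivAt.comp (h₂ := fun w ↦ thetaSum w (-1 / τ)) 0 ?_
        ((hasDerivAt_id (0 : ℂ)).div_const τ)
      simpa using hasDerivAt_thetaSum_zero (im_neg_one_div_pos hτ)
    have d2 : DifferentiableAt ℂ
        (fun w : ℂ ↦ K * cexp (Real.pi * I * (w ^ 2 / τ + w / τ - w))) 0 := by fun_prop
    have d3 := d2.hasDerivAt.fun_mul (hasDerivAt_thetaSum_zero hτ)
    have := ((funext h : (fun w ↦ _) = _) ▸ d1).unique d3
    simp [thetaSum_zero] at this
    field_simp at this
    rw [neg_div, this]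
  rw [recipTheta, recipTheta, h, hnull]
  rcases eq_or_ne (thetaSum w τ) 0 with hw | hw
  · simp [hw]
  · have e1 : qpow (w / τ) (1 / 2) = cexp (-(Real.pi * I * (w ^ 2 / τ))) * qpow w (1 / 2) *
        cexp (Real.pi * I * (w ^ 2 / τ + w / τ - w)) := by
      rw [qpow, qpow, ← Complex.exp_add, ← Complex.exp_add]; ring_nf
    have e2 := Complex.exp_ne_zero (Real.pi * I * (w ^ 2 / τ + w / τ - w))
    rw [e1]
    set B := cexp (Real.pi * I * (w ^ 2 / τ + w / τ - w))
    rw [div_eq_iff (mul_ne_zero (mul_ne_zero hK e2) hw)]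
    field_simp

lemma denom_ne_zero_and_im_pos (γ : SL(2, ℤ)) {τ : ℂ} (hτ : 0 < τ.im) :
    (γ 1 0 : ℂ) * τ + (γ 1 1 : ℂ) ≠ 0 ∧
      0 < (((γ 0 0 : ℂ) * τ + (γ 0 1 : ℂ)) / ((γ 1 0 : ℂ) * τ + (γ 1 1 : ℂ))).im := by
  have h := (γ • (⟨τ, hτ⟩ : UpperHalfPlane)).im_pos
  rw [← UpperHalfPlane.coe_im, UpperHalfPlane.coe_specialLinearGroup_apply] at h
  have h' : 0 < (((γ 0 0 : ℂ) * τ + (γ 0 1 : ℂ)) / ((γ 1 0 : ℂ) * τ + (γ 1 1 : ℂ))).im := by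
    simpa using h
  exact ⟨fun h0 ↦ by simp [h0] at h', h'⟩

/-- S and T generate SL(2, ℤ), and the automorphy factor satisfies the cocycle relation, so the law
passes to products and inverses. -/
lemma recipTheta_modular (γ : SL(2, ℤ)) : ∀ (w τ : ℂ), 0 < τ.im →
    recipTheta (w / ((γ 1 0 : ℂ) * τ + (γ 1 1 : ℂ)))
      (((γ 0 0 : ℂ) * τ + (γ 0 1 : ℂ)) / ((γ 1 0 : ℂ) * τ + (γ 1 1 : ℂ))) =
    ((γ 1 0 : ℂ) * τ + (γ 1 1 : ℂ)) *
      cexp (-(Real.pi * I * ((γ 1 0 : ℂ) * w ^ 2 / ((γ 1 0 : ℂ) * τ + (γ 1 1 : ℂ))))) *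
      recipTheta w τ := by
  have hmem : γ ∈ Subgroup.closure {ModularGroup.S, ModularGroup.T} := by
    simp [_root_.SpecialLinearGroup.SL2Z_generators]
  induction hmem using Subgroup.closure_induction with
  | mem x hx =>
    intro w τ hτ
    rcases hx with rfl | rfl
    · simpa [ModularGroup.S] using recipTheta_S hτ w
    · simpa [ModularGroup.T] using recipTheta_T w τ
  | one => intro w τ hτ; simp
  | mul x y _ _ hx hy =>
    intro w τ hτ
    obtain ⟨hJ, him⟩ := denom_ne_zero_and_im_pos y hτ
    obtain ⟨hJ', -⟩ := denom_ne_zero_and_im_pos x him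
    have h1 := hx (w / ((y 1 0 : ℂ) * τ + (y 1 1 : ℂ))) _ him
    rw [hy w τ hτ] at h1
    have hdet : (y 0 0 : ℂ) * y 1 1 - y 0 1 * y 1 0 = 1 := by
      have := y.det_coe
      rw [Matrix.det_fin_two] at this
      exact_mod_cast this
    simp only [Matrix.SpecialLinearGroup.coe_mul, Matrix.mul_apply, Fin.sum_univ_two]
    push_cast
    set a := (x 0 0 : ℂ)
    set b := (x 0 1 : ℂ)
    set c := (x 1 0 : ℂ)
    set d := (x 1 1 : ℂ)
    set a' := (y 0 0 : ℂ)
    set b' := (y 0 1 : ℂ)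
    set c' := (y 1 0 : ℂ)
    set d' := (y 1 1 : ℂ)
    set J := c' * τ + d' with hJdef
    set X := (a' * τ + b') / J with hXdef
    have hX : X * J = a' * τ + b' := div_mul_cancel₀ _ hJ
    set J' := c * X + d with hJdef'
    have eJ : (c * a' + d * c') * τ + (c * b' + d * d') = J' * J := by
      rw [hJdef']; linear_combination (-c) * hX - d * hJdef
    have eN : (a * a' + b * c') * τ + (a * b' + b * d') = (a * X + b) * J := by
      linear_combination (-a) * hX - b * hJdef
    rw [eJ, eN, mul_div_mul_right _ _ hJ, mul_comm J' J, ← div_div, h1]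
    have eE : cexp (-(Real.pi * I * ((c * a' + d * c') * w ^ 2 / (J * J')))) =
        cexp (-(Real.pi * I * (c * (w / J) ^ 2 / J'))) * cexp (-(Real.pi * I * (c' * w ^ 2 / J))) := by
      rw [← Complex.exp_add]
      congr 1
      -- The cocycle relation for the exponents, a consequence of the determinant of y being 1.
      have : (c * a' + d * c') * J = c + c' * (J' * J) := by
        rw [← eJ, hJdef]
        linear_combination c * hdet
      clear_value J J'
      field_simp
      linear_combination -w ^ 2 * this
    rw [eE]
    ring
  | inv x _ hx =>
    intro w τ hτ
    obtain ⟨hJ, him⟩ := denom_ne_zero_and_im_pos x⁻¹ hτ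
    have h1 := hx (w / ((x⁻¹ 1 0 : ℂ) * τ + (x⁻¹ 1 1 : ℂ))) _ him
    have hdet : (x 0 0 : ℂ) * x 1 1 - x 0 1 * x 1 0 = 1 := by
      have := x.det_coe
      rw [Matrix.det_fin_two] at this
      exact_mod_cast this
    have e00 : x⁻¹ 0 0 = x 1 1 := by
      simp [Matrix.SpecialLinearGroup.coe_inv, Matrix.adjugate_fin_two]
    have e01 : x⁻¹ 0 1 = -x 0 1 := by
      simp [Matrix.SpecialLinearGroup.coe_inv, Matrix.adjugate_fin_two]
    have e10 : x⁻¹ 1 0 = -x 1 0 := by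
      simp [Matrix.SpecialLinearGroup.coe_inv, Matrix.adjugate_fin_two]
    have e11 : x⁻¹ 1 1 = x 0 0 := by
      simp [Matrix.SpecialLinearGroup.coe_inv, Matrix.adjugate_fin_two]
    simp only [e00, e01, e10, e11] at hJ h1 ⊢
    push_cast at hJ h1 ⊢
    set a := (x 0 0 : ℂ)
    set b := (x 0 1 : ℂ)
    set c := (x 1 0 : ℂ)
    set d := (x 1 1 : ℂ)
    set J := -c * τ + a with hJdef
    have eJ : c * ((d * τ + -b) / J) + d = J⁻¹ := by
      field_simp
      rw [hJdef]
      linear_combination hdet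
    have eN : (a * ((d * τ + -b) / J) + b) = τ * J⁻¹ := by
      field_simp
      rw [hJdef]
      linear_combination τ * hdet
    rw [eJ, eN, mul_div_cancel_right₀ _ (inv_ne_zero hJ), div_inv_eq_mul, div_mul_cancel₀ _ hJ] at h1
    rw [h1]
    have eE : cexp (-(Real.pi * I * (-c * w ^ 2 / J))) *
        cexp (-(Real.pi * I * (c * (w / J) ^ 2 / J⁻¹))) = 1 := by
      rw [← Complex.exp_add, Complex.exp_eq_one_iff]
      refine ⟨0, ?_⟩
      field_simp
      ring
    have hJJ : J * J⁻¹ = 1 := mul_inv_cancel₀ hJ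
    set R := recipTheta (w / J) ((d * τ + -b) / J)
    linear_combination (-(J * J⁻¹ * R)) * eE - R * hJJ

/-! ### Zeros of theta and reduction of general a to a = 1 -/

lemma thetaNull_ne_zero {τ : ℂ} (hτ : 0 < τ.im) : thetaNull τ ≠ 0 := by
  rw [thetaNull_eq_eulerProd hτ]
  exact pow_ne_zero _ (eulerProd_ne_zero (norm_qpow_one_lt_one hτ))

/-- The theta function vanishes exactly at the lattice points. -/
lemma thetaSum_ne_zero_iff {w τ : ℂ} (hτ : 0 < τ.im) :
    thetaSum w τ ≠ 0 ↔ ∀ n : ℤ, qpow τ n * qpow w 1 ≠ 1 := by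
  refine ⟨fun h n hn ↦ h ?_, fun hw h ↦ ?_⟩
  · have := one_sub_mul_tsum_thetaPartial hτ n w
    rw [hn, sub_self, zero_mul, eq_comm] at this
    exact (mul_eq_zero.mp this).resolve_left
      (mul_ne_zero (zpow_ne_zero _ (by norm_num)) (qpow_ne_zero _ _))
  · have := tsum_div_mul_thetaSum hτ 0 w hw
    rw [h, mul_zero, eq_comm] at this
    exact mul_ne_zero (qpow_ne_zero _ _) (thetaNull_ne_zero hτ) this

/-- Multiplied by the nonzero constant θ(y), the terms are the row sums of an absolutely convergent
double series. -/
lemma summable_div_one_sub {τ : ℂ} (hτ : 0 < τ.im) (m : ℤ) (w : ℂ)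
    (hw : ∀ n : ℤ, qpow τ n * qpow w 1 ≠ 1) :
    Summable fun n : ℤ ↦ (-1) ^ n * qpow τ (((n : ℂ) ^ 2 + (2 * m + 1) * n) / 2) /
      (1 - qpow τ n * qpow w 1) := by
  have h0 := (thetaSum_ne_zero_iff hτ).mpr hw
  rw [← summable_mul_right_iff h0]
  simp only [fun n ↦ div_mul_thetaSum_eq hτ m n w (hw n)]
  exact (summable_prod_thetaPartial hτ m w).prod

/-- Partial fractions of `a / (1 - x ^ a)` over the `a`-th roots of unity. -/
lemma sum_one_div_one_sub_mul {a : ℕ} (ha : 0 < a) {ζ : ℂ} (hζ : IsPrimitiveRoot ζ a) {x : ℂ}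
    (hx : x ^ a ≠ 1) :
    ∑ k ∈ Finset.range a, 1 / (1 - ζ ^ k * x) = a / (1 - x ^ a) := by
  have hx' : 1 - x ^ a ≠ 0 := sub_ne_zero.mpr hx.symm
  have hpow (k : ℕ) : (ζ ^ k * x) ^ a = x ^ a := by
    rw [mul_pow, ← pow_mul, mul_comm k, pow_mul, hζ.pow_eq_one, one_pow, one_mul]
  have h1 (k : ℕ) : 1 / (1 - ζ ^ k * x) =
      (∑ m ∈ Finset.range a, (ζ ^ k * x) ^ m) / (1 - x ^ a) := by
    have h := mul_neg_geom_sum (ζ ^ k * x) a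
    rw [hpow] at h
    have h2 : 1 - ζ ^ k * x ≠ 0 := left_ne_zero_of_mul (h ▸ hx')
    rw [div_eq_div_iff h2 hx', one_mul, ← h, mul_comm]
  simp only [h1]
  rw [← Finset.sum_div, Finset.sum_comm]
  congr 1
  rw [Finset.sum_eq_single 0]
  · simp
  · intro m hm hm0
    have hm1 : ζ ^ m ≠ 1 := hζ.pow_ne_one_of_pos_of_lt hm0 (Finset.mem_range.mp hm)
    have h := mul_neg_geom_sum (ζ ^ m) a
    rw [← pow_mul, mul_comm m, pow_mul, hζ.pow_eq_one, one_pow, sub_self] at h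
    have h2 := (mul_eq_zero.mp h).resolve_left (sub_ne_zero.mpr hm1.symm)
    calc _ = (∑ k ∈ Finset.range a, (ζ ^ m) ^ k) * x ^ m := by
          rw [Finset.sum_mul]
          refine Finset.sum_congr rfl fun k _ ↦ ?_
          rw [mul_pow, ← pow_mul, ← pow_mul, mul_comm k]
      _ = 0 := by rw [h2, zero_mul]
  · intro h; exact absurd (Finset.mem_range.mpr ha) h

lemma qpow_pow_nat (τ x : ℂ) (n : ℕ) : qpow τ x ^ n = qpow τ (n * x) := by
  rw [qpow, qpow, ← Complex.exp_nat_mul]; ring_nf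

lemma qpow_div_pow {a : ℕ} (ha : 0 < a) (z : ℂ) (k : ℕ) :
    qpow ((z + k) / a) 1 ^ a = qpow z 1 := by
  have ha' : (a : ℂ) ≠ 0 := by exact_mod_cast ha.ne'
  rw [qpow_pow_nat, mul_one, qpow, qpow, Complex.exp_eq_exp_iff_exists_int]
  exact ⟨k, by push_cast; field_simp⟩

lemma regular_div {a : ℕ} (ha : 0 < a) {z τ : ℂ}
    (h : ∀ n : ℤ, qpow τ (a * n) * qpow z 1 ≠ 1) (k : ℕ) (n : ℤ) :
    qpow τ n * qpow ((z + k) / a) 1 ≠ 1 := by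
  intro h1
  refine h n ?_
  rw [← qpow_div_pow ha z k, ← qpow_pow_nat, ← mul_pow, h1, one_pow]

/-- Partial fractions at x = q^n exp(2πiz/a): replacing z by z + k multiplies x by ζ^k. -/
lemma appellTerm_eq_sum {a : ℕ} (ha : 0 < a) (s : ℤ) {z τ : ℂ}
    (h : ∀ n : ℤ, qpow τ (a * n) * qpow z 1 ≠ 1) (n : ℤ) :
    appellTerm a s z τ n = ∑ k ∈ Finset.range a, (1 / (a : ℂ)) *
      ((-1) ^ n * qpow τ (((n : ℂ) ^ 2 + s * n) / 2) /
        (1 - qpow τ n * qpow ((z + k) / a) 1)) := by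
  have ha' : (a : ℂ) ≠ 0 := by exact_mod_cast ha.ne'
  have hx : (qpow τ n * qpow (z / a) 1) ^ a = qpow τ (a * n) * qpow z 1 := by
    have := qpow_div_pow ha z 0
    rw [Nat.cast_zero, add_zero] at this
    rw [mul_pow, this, qpow_pow_nat]
  have key := sum_one_div_one_sub_mul ha (Complex.isPrimitiveRoot_exp a ha.ne')
    (x := qpow τ n * qpow (z / a) 1) (hx ▸ h n)
  have hk (k : ℕ) : cexp (2 * Real.pi * I / a) ^ k * (qpow τ n * qpow (z / a) 1) =
      qpow τ n * qpow ((z + k) / a) 1 := by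
    rw [mul_left_comm, add_div, qpow_add_left, ← Complex.exp_nat_mul, mul_comm (qpow (z / a) 1)]
    simp only [qpow]; ring_nf
  simp only [hk, hx] at key
  rw [← Finset.mul_sum]
  simp only [div_eq_mul_one_div (_ * _ : ℂ) (1 - _)]
  rw [← Finset.mul_sum, key, appellTerm]
  field_simp

lemma summable_appellTerm {a : ℕ} (ha : 0 < a) {s : ℤ} (hs : Odd s) {z τ : ℂ} (hτ : 0 < τ.im)
    (h : ∀ n : ℤ, qpow τ (a * n) * qpow z 1 ≠ 1) : Summable (appellTerm a s z τ) := by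
  obtain ⟨m, rfl⟩ := hs
  rw [funext (appellTerm_eq_sum ha (2 * m + 1) h)]
  refine summable_sum fun k _ ↦ .mul_left _ ?_
  simpa using summable_div_one_sub hτ m _ (regular_div ha h k)

/-- The combination of translates of `recipTheta` that represents `appellForm`. -/
noncomputable def recipThetaSum (a : ℕ) (s : ℤ) (p : ℂ × ℂ) : ℂ :=
  ∑ k ∈ Finset.range a, (1 / (a : ℂ)) * cexp (-(Real.pi * I * (k * s / a))) *
    recipTheta ((p.1 + k) / a) p.2

theorem appellForm_eq_recipThetaSum {a : ℕ} (ha : 0 < a) {s : ℤ} (hs : Odd s) {z τ : ℂ}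
    (hτ : 0 < τ.im) (h : ∀ n : ℤ, qpow τ (a * n) * qpow z 1 ≠ 1) :
    appellForm a s (z, τ) = recipThetaSum a s (z, τ) := by
  obtain ⟨m, rfl⟩ := hs
  have ha' : (a : ℂ) ≠ 0 := by exact_mod_cast ha.ne'
  have hsum (k : ℕ) := summable_div_one_sub hτ m _ (regular_div ha h k)
  rw [appellForm, recipThetaSum]
  dsimp only
  rw [funext (appellTerm_eq_sum ha (2 * m + 1) h)]
  push_cast
  rw [Summable.tsum_finsetSum fun k _ ↦ (hsum k).mul_left _, Finset.mul_sum]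
  refine Finset.sum_congr rfl fun k _ ↦ ?_
  have hne := (thetaSum_ne_zero_iff hτ).mpr (regular_div ha h k)
  have h1 := tsum_div_mul_thetaSum hτ m _ (regular_div ha h k)
  rw [tsum_mul_left, eq_div_iff hne |>.mpr h1, recipTheta]
  -- With s = 2m + 1, the prefactor u^(s/(2a)) and y^(-m) combine to the y^(1/2) of `recipTheta`, up
  -- to a root of unity.
  have h2 : qpow z ((2 * m + 1) / (2 * a)) * qpow ((z + k) / a) (-m) =
      cexp (-(Real.pi * I * (k * (2 * m + 1) / a))) * qpow ((z + k) / a) (1 / 2) := by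
    simp only [qpow, ← Complex.exp_add]
    congr 1
    field_simp
    ring
  linear_combination (1 / (a : ℂ)) * thetaNull τ / thetaSum ((z + k) / a) τ * h2

/-! ### Holomorphy off the poles -/

lemma analyticAt_thetaNull {τ : ℂ} (hτ : 0 < τ.im) : AnalyticAt ℂ thetaNull τ := by
  have h1 : AnalyticAt ℂ eulerProd (qpow τ 1) :=
    ModularForm.differentiableOn_tprod_one_sub_pow.analyticAt
      (Metric.isOpen_ball.mem_nhds (by simpa using norm_qpow_one_lt_one hτ))
  have h2 : AnalyticAt ℂ (fun τ ↦ qpow τ 1) τ := by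
    unfold qpow
    fun_prop
  refine ((AnalyticAt.comp_of_eq h1 h2 rfl).pow 3).congr ?_
  filter_upwards [(isOpen_lt continuous_const continuous_im).mem_nhds hτ] with τ' hτ'
  exact (thetaNull_eq_eulerProd hτ').symm

lemma analyticAt_thetaSum_div (c : ℂ) (k : ℂ) {z τ : ℂ} (hτ : 0 < τ.im) :
    AnalyticAt ℂ (fun p : ℂ × ℂ ↦ thetaSum ((p.1 + k) / c) p.2) (z, τ) := by
  have h : AnalyticAt ℂ (fun p : ℂ × ℂ ↦ ((p.1 + k) / c, p.2)) (z, τ) := by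
    simp only [div_eq_mul_inv]
    exact AnalyticAt.prod ((analyticAt_fst.add analyticAt_const).mul analyticAt_const)
      analyticAt_snd
  exact AnalyticAt.comp_of_eq (analyticAt_thetaSum (w := (z + k) / c) hτ) h rfl

lemma analyticAt_recipThetaSum {a : ℕ} (s : ℤ) {z τ : ℂ} (hτ : 0 < τ.im)
    (h : ∀ k : ℕ, thetaSum ((z + k) / a) τ ≠ 0) :
    AnalyticAt ℂ (recipThetaSum a s) (z, τ) := by
  unfold recipThetaSum
  refine Finset.analyticAt_fun_sum _ fun k _ ↦ analyticAt_const.mul ?_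
  unfold recipTheta
  refine AnalyticAt.fun_div (.mul ?_ ?_) (analyticAt_thetaSum_div a k hτ) (h k)
  · simp only [qpow, div_eq_mul_inv]
    exact ((analyticAt_const.mul ((analyticAt_fst.add analyticAt_const).mul
      analyticAt_const)).mul analyticAt_const).cexp
  · exact AnalyticAt.comp_of_eq (analyticAt_thetaNull hτ) analyticAt_snd rfl

lemma im_natCast_mul_pos {a : ℕ} (ha : 0 < a) {τ : ℂ} (hτ : 0 < τ.im) : 0 < ((a : ℂ) * τ).im := by
  have : (0 : ℝ) < a := by exact_mod_cast ha
  simpa using mul_pos this hτ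

/-- Encodes infinitely many conditions as the nonvanishing of one analytic function, so that the
regular set is open. -/
lemma thetaSum_natCast_mul_ne_zero_iff {a : ℕ} (ha : 0 < a) {z τ : ℂ} (hτ : 0 < τ.im) :
    thetaSum z (a * τ) ≠ 0 ↔ ∀ n : ℤ, qpow τ (a * n) * qpow z 1 ≠ 1 := by
  rw [thetaSum_ne_zero_iff (im_natCast_mul_pos ha hτ)]
  have (n : ℤ) : qpow ((a : ℂ) * τ) n = qpow τ (a * n) := by simp only [qpow]; ring_nf
  simp only [this]

lemma analyticAt_thetaSum_natCast_mul {a : ℕ} (ha : 0 < a) {z τ : ℂ} (hτ : 0 < τ.im) :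
    AnalyticAt ℂ (fun p : ℂ × ℂ ↦ thetaSum p.1 (a * p.2)) (z, τ) := by
  have h : AnalyticAt ℂ (fun p : ℂ × ℂ ↦ (p.1, (a : ℂ) * p.2)) (z, τ) :=
    AnalyticAt.prod analyticAt_fst (analyticAt_const.mul analyticAt_snd)
  have h' := analyticAt_thetaSum (w := z) (im_natCast_mul_pos ha hτ)
  exact AnalyticAt.comp_of_eq (g := fun p : ℂ × ℂ ↦ thetaSum p.1 p.2)
    (f := fun p : ℂ × ℂ ↦ (p.1, (a : ℂ) * p.2)) h' h rfl

lemma eventually_im_pos {z τ : ℂ} (hτ : 0 < τ.im) : ∀ᶠ p : ℂ × ℂ in 𝓝 (z, τ), 0 < p.2.im :=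
  (isOpen_lt continuous_const (continuous_im.comp continuous_snd)).mem_nhds hτ

theorem analyticAt_appellForm {a : ℕ} (ha : 0 < a) {s : ℤ} (hs : Odd s) {z τ : ℂ} (hτ : 0 < τ.im)
    (h : ∀ n : ℤ, qpow τ (a * n) * qpow z 1 ≠ 1) : AnalyticAt ℂ (appellForm a s) (z, τ) := by
  refine (analyticAt_recipThetaSum s hτ
    fun k ↦ (thetaSum_ne_zero_iff hτ).mpr (regular_div ha h k)).congr ?_
  have h1 := (analyticAt_thetaSum_natCast_mul ha hτ).continuousAt.eventually_ne
    ((thetaSum_natCast_mul_ne_zero_iff ha hτ).mpr h)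
  filter_upwards [h1, eventually_im_pos hτ] with p hp him
  exact (appellForm_eq_recipThetaSum ha hs him
    ((thetaSum_natCast_mul_ne_zero_iff ha him).mp hp)).symm

/-! ### Transformation laws and meromorphy -/

lemma countable_not_regular (a : ℕ) (τ : ℂ) :
    {z : ℂ | ∀ n : ℤ, qpow τ (a * n) * qpow z 1 ≠ 1}ᶜ.Countable := by
  refine (Set.countable_range fun x : ℤ × ℤ ↦ (x.2 : ℂ) - a * x.1 * τ).mono fun z hz ↦ ?_
  simp only [Set.mem_compl_iff, Set.mem_ofPred_eq, not_forall, not_not] at hz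
  obtain ⟨n, hn⟩ := hz
  rw [qpow, qpow, ← Complex.exp_add, Complex.exp_eq_one_iff] at hn
  obtain ⟨k, hk⟩ := hn
  have hpi : (2 * Real.pi * I : ℂ) ≠ 0 := by simp [Real.pi_ne_zero]
  refine ⟨(n, k), mul_left_cancel₀ hpi ?_⟩
  linear_combination -hk

/-- Carries identities proved at regular points to points where the series may be singular term by
term but both sides are still continuous. -/
lemma eq_of_eq_off_countable {f g : ℂ → ℂ} {z : ℂ} (hf : ContinuousAt f z)
    (hg : ContinuousAt g z) {S : Set ℂ} (hS : S.Countable) (h : ∀ x ∉ S, f x = g x) :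
    f z = g z := by
  have : (𝓝[Sᶜ] z).NeBot :=
    mem_closure_iff_nhdsWithin_neBot.mp (hS.dense_compl ℂ z)
  refine tendsto_nhds_unique (l := 𝓝[Sᶜ] z) (hf.tendsto.mono_left nhdsWithin_le_nhds)
    ((hg.tendsto.mono_left nhdsWithin_le_nhds).congr' ?_)
  filter_upwards [self_mem_nhdsWithin] with x hx
  exact (h x hx).symm

/-- After division by a, a shift by a multiple of 2a² is an even lattice shift: the signs disappear,
and k/a contributes only exp(2πi · 2kv) = 1. -/
lemma recipThetaSum_add {a : ℕ} (ha : 0 < a) (s : ℤ) (z τ : ℂ) (v l : ℤ) :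
    recipThetaSum a s (z + τ * (2 * a ^ 2 * v) + 2 * a ^ 2 * l, τ) =
      qpow τ (2 * a ^ 2 * v ^ 2) * qpow z (2 * v) * recipThetaSum a s (z, τ) := by
  have ha' : (a : ℂ) ≠ 0 := by exact_mod_cast ha.ne'
  rw [recipThetaSum, recipThetaSum, Finset.mul_sum]
  refine Finset.sum_congr rfl fun k _ ↦ ?_
  have h1 : (z + τ * (2 * a ^ 2 * v) + 2 * a ^ 2 * l + k) / a =
      (z + k) / a + (2 * a * v : ℤ) * τ + (2 * a * l : ℤ) := by
    push_cast; field_simp; ring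
  have h2 : (-1 : ℂ) ^ (2 * a * v + 2 * a * l : ℤ) = 1 :=
    Even.neg_one_zpow ⟨a * v + a * l, by ring⟩
  have h3 : qpow ((z + k) / a) (2 * a * v : ℤ) = qpow z (2 * v) := by
    rw [qpow, qpow, Complex.exp_eq_exp_iff_exists_int]
    exact ⟨2 * k * v, by push_cast; field_simp⟩
  have h4 : qpow τ (((2 * a * v : ℤ) : ℂ) ^ 2 / 2) = qpow τ (2 * a ^ 2 * v ^ 2) := by
    congr 1; push_cast; ring
  dsimp only
  rw [h1, recipTheta_add, h2, h3, h4]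
  ring

/-- The transformed argument involves z + kJ instead of z + k. Since the lower row is congruent to
(0, 1) modulo 2a², they differ, after division by a, by an even lattice shift, so the summands are
not permuted. -/
lemma recipThetaSum_modular {a : ℕ} (ha : 0 < a) (s : ℤ) {γ : SL(2, ℤ)} {c' d' : ℤ}
    (hc : γ 1 0 = 2 * a ^ 2 * c') (hd : γ 1 1 = 1 + 2 * a ^ 2 * d') (z : ℂ) {τ : ℂ}
    (hτ : 0 < τ.im) :
    recipThetaSum a s (((γ 1 0 : ℂ) * τ + (γ 1 1 : ℂ))⁻¹ * z,
        ((γ 0 0 : ℂ) * τ + (γ 0 1 : ℂ)) / ((γ 1 0 : ℂ) * τ + (γ 1 1 : ℂ))) =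
      ((γ 1 0 : ℂ) * τ + (γ 1 1 : ℂ)) *
        cexp (-(2 * Real.pi * I * (c' * z ^ 2 / ((γ 1 0 : ℂ) * τ + (γ 1 1 : ℂ))))) *
        recipThetaSum a s (z, τ) := by
  have ha' : (a : ℂ) ≠ 0 := by exact_mod_cast ha.ne'
  obtain ⟨hJ, -⟩ := denom_ne_zero_and_im_pos γ hτ
  rw [recipThetaSum, recipThetaSum, Finset.mul_sum]
  refine Finset.sum_congr rfl fun k _ ↦ ?_
  have hmod := recipTheta_modular γ
    ((z + k * ((γ 1 0 : ℂ) * τ + (γ 1 1 : ℂ))) / a) τ hτ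
  have hcC : (γ 1 0 : ℂ) = 2 * a ^ 2 * c' := by rw [hc]; push_cast; ring
  have hdC : (γ 1 1 : ℂ) = 1 + 2 * a ^ 2 * d' := by rw [hd]; push_cast; ring
  set J := (γ 1 0 : ℂ) * τ + (γ 1 1 : ℂ) with hJdef
  have h0 : (J⁻¹ * z + k) / a = (z + k * J) / a / J := by field_simp
  have h1 : (z + k * J) / a =
      (z + k) / a + (2 * a * (c' * k) : ℤ) * τ + (2 * a * (d' * k) : ℤ) := by
    rw [hJdef, hcC, hdC]; push_cast; field_simp; ring
  have h2 : (-1 : ℂ) ^ (2 * a * (c' * k) + 2 * a * (d' * k) : ℤ) = 1 :=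
    Even.neg_one_zpow ⟨a * (c' * k) + a * (d' * k), by ring⟩
  dsimp only
  rw [h0, hmod, h1, recipTheta_add, h2, ← h1]
  have h3 : cexp (-(Real.pi * I * ((γ 1 0 : ℂ) * ((z + k * J) / a) ^ 2 / J))) *
      (qpow τ (((2 * a * (c' * k) : ℤ) : ℂ) ^ 2 / 2) *
        qpow ((z + k) / a) (2 * a * (c' * k) : ℤ)) =
      cexp (-(2 * Real.pi * I * (c' * z ^ 2 / J))) := by
    rw [qpow, qpow, ← Complex.exp_add, ← Complex.exp_add, Complex.exp_eq_exp_iff_exists_int]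
    -- The terms linear in z cancel; writing J = 2a²c'τ + 1 + 2a²d' cancels those in τ and leaves
    -- this integer.
    refine ⟨-(c' * k ^ 2 * (1 + 2 * a ^ 2 * d')) + 2 * c' * k ^ 2, ?_⟩
    have hJ2 : J = 2 * a ^ 2 * c' * τ + (1 + 2 * a ^ 2 * d') := by rw [hJdef, hcC, hdC]
    rw [hcC]
    clear_value J
    push_cast
    field_simp
    linear_combination (-((c' : ℂ) * k ^ 2 * J)) * hJ2
  linear_combination (1 / (a : ℂ)) * cexp (-(Real.pi * I * (k * s / a))) * J *
    recipTheta ((z + k) / a) τ * h3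

lemma isMeromorphicAt_appellForm {a : ℕ} (ha : 0 < a) {s : ℤ} (hs : Odd s) (z : ℂ) {τ : ℂ}
    (hτ : 0 < τ.im) : IsMeromorphicAt (appellForm a s) (z, τ) := by
  let θ (k : ℕ) (p : ℂ × ℂ) : ℂ := thetaSum ((p.1 + k) / a) p.2
  let θ₀ (p : ℂ × ℂ) : ℂ := thetaSum p.1 (a * p.2)
  have hθ (k : ℕ) : AnalyticAt ℂ (θ k) (z, τ) := analyticAt_thetaSum_div a k hτ
  have hθ₀ : AnalyticAt ℂ θ₀ (z, τ) := analyticAt_thetaSum_natCast_mul ha hτ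
  -- The summands are put over a common denominator. The extra factor θ₀ ensures that a nonzero
  -- denominator implies regularity, where the series equals `recipThetaSum`.
  refine ⟨fun p ↦ θ₀ p * ∑ k ∈ Finset.range a, (1 / (a : ℂ)) *
    cexp (-(Real.pi * I * (k * s / a))) * (qpow ((p.1 + k) / a) (1 / 2) * thetaNull p.2) *
      ∏ j ∈ (Finset.range a).erase k, θ j p,
    fun p ↦ θ₀ p * ∏ k ∈ Finset.range a, θ k p, ?_, ?_, ?_, ?_⟩
  · refine hθ₀.mul (Finset.analyticAt_fun_sum _ fun k _ ↦ .mul (.mul analyticAt_const (.mul ?_ ?_))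
      (Finset.analyticAt_fun_prod _ fun j _ ↦ hθ j))
    · simp only [qpow, div_eq_mul_inv]
      exact ((analyticAt_const.mul ((analyticAt_fst.add analyticAt_const).mul
        analyticAt_const)).mul analyticAt_const).cexp
    · exact AnalyticAt.comp_of_eq (analyticAt_thetaNull hτ) analyticAt_snd rfl
  · exact hθ₀.mul (Finset.analyticAt_fun_prod _ fun j _ ↦ hθ j)
  · have hfreq : ∃ᶠ z' in 𝓝 z, ∀ n : ℤ, qpow τ (a * n) * qpow z' 1 ≠ 1 := by
      have := (countable_not_regular a τ).dense_compl ℂ z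
      rw [compl_compl] at this
      exact mem_closure_iff_frequently.mp this
    have ht : Tendsto (fun z' : ℂ ↦ (z', τ)) (𝓝 z) (𝓝 (z, τ)) :=
      (Continuous.prodMk_left τ).tendsto z
    refine ht.frequently (hfreq.mono fun z' hz' ↦ mul_ne_zero ?_ ?_)
    · exact (thetaSum_natCast_mul_ne_zero_iff ha hτ).mpr hz'
    · exact Finset.prod_ne_zero_iff.mpr fun k _ ↦
        (thetaSum_ne_zero_iff hτ).mpr (regular_div ha hz' k)
  · filter_upwards [eventually_im_pos hτ] with p him hp
    have h0 : θ₀ p ≠ 0 := left_ne_zero_of_mul hp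
    have hreg := (thetaSum_natCast_mul_ne_zero_iff ha him).mp h0
    rw [appellForm_eq_recipThetaSum ha hs him hreg, mul_div_mul_left _ _ h0, Finset.sum_div,
      recipThetaSum]
    refine Finset.sum_congr rfl fun k hk ↦ ?_
    have hprod := right_ne_zero_of_mul hp
    rw [← Finset.mul_prod_erase _ (fun j ↦ θ j p) hk] at hprod ⊢
    rw [mul_div_mul_right _ _ (right_ne_zero_of_mul hprod), recipTheta,
      mul_div_assoc (_ * _ : ℂ) (_ * _ : ℂ)]

lemma continuousAt_slice {f : ℂ × ℂ → ℂ} {φ : ℂ → ℂ} {z τ : ℂ} (hφ : ContinuousAt φ z)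
    (hf : AnalyticAt ℂ f (φ z, τ)) : ContinuousAt (fun x ↦ f (φ x, τ)) z :=
  ContinuousAt.comp (f := fun x ↦ (φ x, τ)) hf.continuousAt (hφ.prodMk continuousAt_const)

theorem isMeromorphicJacobiForm_appellForm {a : ℕ} (ha : 0 < a) {s : ℤ} (hs : Odd s) :
    IsMeromorphicJacobiForm 1 (Submodule.span ℤ {((2 * a ^ 2 : ℕ) : ℂ)})
      ((-1 / (a : ℂ) ^ 2) • LinearMap.mul ℂ ℂ) (CongruenceSubgroup.Gamma (2 * a ^ 2))
      (appellForm a s) := by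
  have ha' : (a : ℂ) ≠ 0 := by exact_mod_cast ha.ne'
  have hN : 2 * a ^ 2 ≠ 0 := by positivity
  have hB (v w : ℂ) : ((-1 / (a : ℂ) ^ 2) • LinearMap.mul ℂ ℂ) v w = -1 / (a : ℂ) ^ 2 * (v * w) := by
    simp
  have hmem {v : ℂ} (hv : v ∈ Submodule.span ℤ {((2 * a ^ 2 : ℕ) : ℂ)}) :
      ∃ m : ℤ, v = 2 * a ^ 2 * m := by
    obtain ⟨m, rfl⟩ := Submodule.mem_span_singleton.mp hv
    exact ⟨m, by rw [zsmul_eq_mul]; push_cast; ring⟩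
  refine ⟨?_, ?_, ?_, ?_, fun z τ hτ ↦ isMeromorphicAt_appellForm ha hs z hτ, ?_, ?_⟩
  · refine ⟨1, (Module.Basis.singleton (Fin 1) ℂ).unitsSMul
      fun _ ↦ Units.mk0 ((2 * a ^ 2 : ℕ) : ℂ) (by exact_mod_cast hN), ?_⟩
    rw [Set.range_unique]
    rw [Module.Basis.unitsSMul_apply, Module.Basis.singleton_apply, Units.smul_def,
      Units.val_mk0, smul_eq_mul, mul_one]
  · intro v w
    rw [hB, hB, mul_comm v]
  · intro v hv w hw
    obtain ⟨m, rfl⟩ := hmem hv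
    obtain ⟨m', rfl⟩ := hmem hw
    refine ⟨-(4 * a ^ 2 * m * m'), ?_⟩
    rw [hB]; push_cast; field_simp; ring
  · have : NeZero (2 * a ^ 2) := ⟨hN⟩
    exact CongruenceSubgroup.Gamma_is_cong_sub _
  · intro v hv w hw z τ hτ h1 h2
    obtain ⟨m, rfl⟩ := hmem hv
    obtain ⟨m', rfl⟩ := hmem hw
    simp only [hB, smul_eq_mul] at h2 ⊢
    -- The form takes the even values -4a²mm' on this lattice, so the sign is trivial.
    have e1 : cexp (Real.pi * I * (-1 / (a : ℂ) ^ 2 * (2 * a ^ 2 * m * (2 * a ^ 2 * m')))) = 1 := by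
      rw [Complex.exp_eq_one_iff]
      refine ⟨-(2 * a ^ 2 * m * m'), ?_⟩
      push_cast; field_simp
    have e2 (z : ℂ) : cexp (-(Real.pi * I * τ * (-1 / (a : ℂ) ^ 2 * (2 * a ^ 2 * m *
        (2 * a ^ 2 * m)))) - 2 * Real.pi * I * (-1 / (a : ℂ) ^ 2 * (2 * a ^ 2 * m * z))) =
        qpow τ (2 * a ^ 2 * m ^ 2) * qpow z (2 * m) := by
      rw [qpow, qpow, ← Complex.exp_add]
      congr 1
      field_simp
      ring
    rw [e1, one_mul, e2]
    refine eq_of_eq_off_countable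
      (f := fun z ↦ appellForm a s (z + τ * (2 * a ^ 2 * m) + 2 * a ^ 2 * m', τ))
      (g := fun z ↦ qpow τ (2 * a ^ 2 * m ^ 2) * qpow z (2 * m) * appellForm a s (z, τ))
      (continuousAt_slice (φ := fun z ↦ z + τ * (2 * a ^ 2 * m) + 2 * a ^ 2 * m') (by fun_prop) h2)
      (.mul (by unfold qpow; fun_prop) (continuousAt_slice (φ := id) continuousAt_id h1))
      ((countable_not_regular a τ).union ((countable_not_regular a τ).preimage
        (f := fun z ↦ z + (τ * (2 * a ^ 2 * m) + 2 * a ^ 2 * m')) (add_left_injective _)))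
      fun x hx ↦ ?_
    rw [Set.mem_union, not_or, Set.mem_preimage, Set.notMem_compl_iff, Set.notMem_compl_iff,
      ← add_assoc] at hx
    rw [appellForm_eq_recipThetaSum ha hs hτ hx.1, appellForm_eq_recipThetaSum ha hs hτ hx.2,
      recipThetaSum_add ha]
  · intro γ hγ z τ hτ h1 h2
    rw [CongruenceSubgroup.Gamma_mem] at hγ
    obtain ⟨-, -, hc, hd⟩ := hγ
    obtain ⟨c', hc'⟩ := (ZMod.intCast_zmod_eq_zero_iff_dvd _ _).mp hc
    obtain ⟨d', hd'⟩ := (ZMod.intCast_zmod_eq_zero_iff_dvd (γ 1 1 - 1) (2 * a ^ 2)).mp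
      (by push_cast; rw [hd, sub_self])
    have hc2 : γ 1 0 = 2 * a ^ 2 * c' := by rw [hc']; push_cast; ring
    have hd2 : γ 1 1 = 1 + 2 * a ^ 2 * d' := by push_cast at hd'; linarith
    obtain ⟨hJ, him⟩ := denom_ne_zero_and_im_pos γ hτ
    have hmod := fun x ↦ recipThetaSum_modular ha s hc2 hd2 x hτ
    have hcC : (γ 1 0 : ℂ) = 2 * a ^ 2 * c' := by rw [hc2]; push_cast; ring
    have e1 (z : ℂ) : cexp (Real.pi * I * ((γ 1 0 : ℂ) * (-1 / (a : ℂ) ^ 2 * (z * z)) /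
        ((γ 1 0 : ℂ) * τ + (γ 1 1 : ℂ)))) =
        cexp (-(2 * Real.pi * I * (c' * z ^ 2 / ((γ 1 0 : ℂ) * τ + (γ 1 1 : ℂ))))) := by
      congr 1
      rw [hcC] at hJ ⊢
      field_simp
    simp only [hB, smul_eq_mul, zpow_one] at h2 ⊢
    rw [e1]
    set J := (γ 1 0 : ℂ) * τ + (γ 1 1 : ℂ)
    set τ' := ((γ 0 0 : ℂ) * τ + (γ 0 1 : ℂ)) / J
    refine eq_of_eq_off_countable (f := fun z ↦ appellForm a s (J⁻¹ * z, τ'))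
      (g := fun z ↦ J * cexp (-(2 * Real.pi * I * (c' * z ^ 2 / J))) * appellForm a s (z, τ))
      (continuousAt_slice (φ := fun z ↦ J⁻¹ * z) (by fun_prop) h2)
      (.mul (by fun_prop) (continuousAt_slice (φ := id) continuousAt_id h1))
      ((countable_not_regular a τ).union ((countable_not_regular a τ').preimage
        (f := fun z ↦ J⁻¹ * z) (mul_right_injective₀ (inv_ne_zero hJ))))
      fun x hx ↦ ?_
    rw [Set.mem_union, not_or, Set.mem_preimage, Set.notMem_compl_iff, Set.notMem_compl_iff] at hx
    rw [appellForm_eq_recipThetaSum ha hs hτ hx.1, appellForm_eq_recipThetaSum ha hs him hx.2,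
      hmod]

/-! ### Nonvanishing of the denominator and the final statement -/

lemma summable_quadSum {τ : ℂ} (hτ : 0 < τ.im) (d : ℤ) (w : ℂ) :
    Summable fun n : ℤ ↦ qpow τ (2 * (n : ℂ) ^ 2 + d * n) * qpow w n := by
  have hpi := Real.pi_pos
  refine .of_norm_bounded (summable_exp_quadratic (A := 4 * Real.pi * τ.im) (by positivity)
    (-(2 * Real.pi * τ.im * d) - 2 * Real.pi * w.im)) fun n ↦ ?_
  rw [norm_mul, norm_qpow_of_eq (y := (2 * n ^ 2 + d * n : ℝ)) (by push_cast; ring),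
    norm_qpow_of_eq (y := (n : ℝ)) (by simp), ← Real.exp_add]
  refine Real.exp_le_exp.mpr (le_of_eq ?_)
  ring

/-- It divides `thetaNull (2 * τ)`, which is the cube of a nonzero Euler product. -/
lemma quadSum_zero_ne_zero {τ : ℂ} (hτ : 0 < τ.im) {d : ℤ} (hd : Odd d) : quadSum d 0 τ ≠ 0 :=
  right_ne_zero_of_mul (tsum_mul_quadSum_zero hτ hd ▸ thetaNull_ne_zero (im_two_mul_pos hτ))

lemma thetaCoeff_two_mul (τ : ℂ) (n : ℤ) :
    thetaCoeff (2 * τ) n = (-1) ^ n * qpow τ ((n : ℂ) ^ 2 - n) := by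
  rw [thetaCoeff, qpow_two_mul]
  congr 2; ring

theorem theorem6 (a : ℕ) (ha : 0 < a) (s : ℤ) (hs : Odd s) :
    -- the series converges absolutely to a holomorphic function off the zeros of `1 - q^(a n) u`
    (∀ z τ : ℂ, 0 < τ.im → (∀ n : ℤ, qpow τ (a * n) * qpow z 1 ≠ 1) →
      Summable (appellTerm a s z τ) ∧ AnalyticAt ℂ (appellForm a s) (z, τ)) ∧
    -- it is a meromorphic Jacobi form of weight `1` for the form `v · w = - v w / a²`
    (∃ N : ℕ, 0 < N ∧ ∃ Γ : Subgroup SL(2, ℤ),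
      IsMeromorphicJacobiForm 1 (Submodule.span ℤ {(N : ℂ)})
        ((-1 / (a : ℂ) ^ 2) • LinearMap.mul ℂ ℂ) Γ (appellForm a s)) ∧
    -- the expression through theta functions for `a = 2`
    (a = 2 → ∀ z τ : ℂ, 0 < τ.im → (∀ n : ℤ, qpow τ (2 * n) * qpow z 1 ≠ 1) →
      Multipliable (fun n : ℕ ↦ 1 - (qpow τ 2) ^ (n + 1)) ∧
      Summable (fun n : ℤ ↦ qpow τ (2 * (n : ℂ) ^ 2 + n * (s - 2)) * qpow z n) ∧
      Summable (fun n : ℤ ↦ (-1 : ℂ) ^ n * qpow τ ((n : ℂ) ^ 2 - n) * qpow z n) ∧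
      Summable (fun n : ℤ ↦ qpow τ (2 * (n : ℂ) ^ 2 + n * (s - 2))) ∧
      (∑' n : ℤ, (-1 : ℂ) ^ n * qpow τ ((n : ℂ) ^ 2 - n) * qpow z n) ≠ 0 ∧
      (∑' n : ℤ, qpow τ (2 * (n : ℂ) ^ 2 + n * (s - 2))) ≠ 0 ∧
      ∑' n : ℤ, (-1 : ℂ) ^ n * qpow τ (((n : ℂ) ^ 2 + n * s) / 2) /
          (1 - qpow τ (2 * n) * qpow z 1) =
        eulerProd (qpow τ 2) ^ 3 *
          ((∑' n : ℤ, qpow τ (2 * (n : ℂ) ^ 2 + n * (s - 2)) * qpow z n) /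
            ((∑' n : ℤ, (-1 : ℂ) ^ n * qpow τ ((n : ℂ) ^ 2 - n) * qpow z n) *
              ∑' n : ℤ, qpow τ (2 * (n : ℂ) ^ 2 + n * (s - 2))))) := by
  refine ⟨fun z τ hτ h ↦ ⟨summable_appellTerm ha hs hτ h, analyticAt_appellForm ha hs hτ h⟩,
    ⟨2 * a ^ 2, by positivity, _, isMeromorphicJacobiForm_appellForm ha hs⟩, ?_⟩
  intro _ z τ hτ h
  have hτ2 := im_two_mul_pos hτ
  have hd : Odd (s - 2) := hs.sub_even even_two
  have hq : qpow (2 * τ) 1 = qpow τ 2 := by rw [qpow_two_mul, mul_one]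
  have hR (w : ℂ) : ∑' n : ℤ, qpow τ (2 * (n : ℂ) ^ 2 + n * (s - 2)) * qpow w n =
      quadSum (s - 2) w τ := by
    refine tsum_congr fun n ↦ ?_
    push_cast
    rw [mul_comm (n : ℂ) (s - 2)]
  have hsR (w : ℂ) : Summable fun n : ℤ ↦ qpow τ (2 * (n : ℂ) ^ 2 + n * (s - 2)) * qpow w n := by
    refine (summable_quadSum hτ (s - 2) w).congr fun n ↦ ?_
    push_cast
    rw [mul_comm (n : ℂ) (s - 2)]
  have hR0 : ∑' n : ℤ, qpow τ (2 * (n : ℂ) ^ 2 + n * (s - 2)) = quadSum (s - 2) 0 τ := by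
    rw [← hR]
    simp [qpow_zero_left]
  have hθ : ∑' n : ℤ, (-1 : ℂ) ^ n * qpow τ ((n : ℂ) ^ 2 - n) * qpow z n = thetaSum z (2 * τ) :=
    tsum_congr fun n ↦ by rw [thetaCoeff_two_mul]
  have hθ0 : thetaSum z (2 * τ) ≠ 0 := by
    refine (thetaSum_ne_zero_iff hτ2).mpr fun n ↦ ?_
    rw [qpow_two_mul]
    exact h n
  have hR0' := quadSum_zero_ne_zero hτ hd
  rw [hR, hθ, hR0]
  refine ⟨ModularForm.multipliable_one_sub_pow (hq ▸ norm_qpow_one_lt_one hτ2), hsR z, ?_, ?_, hθ0,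
    hR0', ?_⟩
  · simpa only [thetaCoeff_two_mul] using summable_thetaCoeff_mul hτ2 z
  · simpa [qpow_zero_left] using hsR 0
  · rw [← hq, ← thetaNull_eq_eulerProd hτ2, ← mul_div_assoc, eq_div_iff (mul_ne_zero hθ0 hR0'),
      ← tsum_div_mul_thetaSum_two hτ hd z h, mul_assoc]
    congr 1
    refine tsum_congr fun n ↦ ?_
    push_cast
    rw [sub_add_cancel, mul_comm (s : ℂ)]
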